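/- Let $n\ge 1$, $m\ge 0$, $s\in\mathbb R$, $t>-n/2$. Write $\hat f(y)=(2\pi)^{-n/2}\int_{\mathbb R^n} f(x)e^{-ix\cdot y}\,dx$, and let $H^s_t(\mathbb R^n)$ be the completion of the (complex-valued) Schwartz functions for the norm $\|f\|^2=\int_{\mathbb R^n}|y|^{2t}(1+|y|^2)^{s-t}|\hat f(y)|^2\,dy$. Let $H^s_t(S^m\mathbb R^n)$ be the space of symmetric $m$-tensor fields with components in $H^s_t(\mathbb R^n)$. On symmetric tensor fields let $d$ be the symmetrized derivative, $(du)_{i_1\dots i_{k+1}}=\sigma\,\partial u_{i_1\dots i_k}/\partial x_{i_{k+1}}$ with $\sigma$ the symmetrization, and let $\delta$ be the divergence, $(\delta u)_{i_1\dots i_{k-1}}=\sum_j\partial u_{i_1\dots i_{k-1}j}/\partial x_j$, both extended from Schwartz fields by continuity (as maps lowering both indices of $H^s_t$ by one; for $t-1\le -n/2$ the space $H^{s-1}_{t-1}(\mathbb R^n)$ is the completion of the Schwartz functions of finite norm). A field $u$ is called divergence-free if $\delta u=0$. Fix a measurable choice, for each $\omega\in\mathbb S^{n-1}$, of an orthonormal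 basis $\omega_1,\dots,\omega_{n-1}$ of $\omega^\perp$. For integers $\ell_1,\dots,\ell_n\ge 0$ with $\ell_1+\dots+\ell_n=m$, the generalized Radon transform of a symmetric Schwartz $m$-tensor field $f$ is $$\mathcal R^m_{\ell_1\dots\ell_n}f(\omega,p)=\int_{\omega^\perp}\big\langle f(p\omega+y),\ \omega_1^{\odot\ell_1}\odot\cdots\odot\omega_{n-1}^{\odot\ell_{n-1}}\odot\omega^{\odot\ell_n}\big\rangle\,dy ,\qquad(\omega,p)\in\mathbb S^{n-1}\times\mathbb R .$$ It is extended to $H^s_t(S^m\mathbb R^n)$ by density, with values in the weighted Sobolev space on $\mathbb S^{n-1}\times\mathbb R$ with squared norm $$\frac1{2(2\pi)^{n-1}}\int_{\mathbb S^{n-1}}\int_{\mathbb R}|\sigma|^{2t+n-1}(1+\sigma^2)^{s-t}|\hat g(\omega,\sigma)|^2\,d\sigma\,d\omega ,$$ where $\hat g$ is the unitary Fourier transform of $g$ in $p$. **Theorem (Kernel characterization).** Let $f\in H^s_t(S^m\mathbb R^n)$ and let $0\le\ell_n\le m$ be fixed. 1. One has $\mathcal R^m_{\ell_1\dots\ell_n}f=0$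 for all $\ell_1,\dots,\ell_{n-1}\ge 0$ with $\ell_1+\dots+\ell_{n-1}=m-\ell_n$ if and only if there are $v_i\in H^{s+i}_{t+i}(S^{m-i}\mathbb R^n)$, $0\le i\le m$, with $v_i$ divergence-free for $i<m$, such that $$f=\sum_{\substack{0\le i\le m\\ i\ne\ell_n}}d^iv_i .$$ 2. The transforms indexed by $\ell_n$ see only the component $v_{\ell_n}$: if $f=\sum_{i=0}^m d^iv_i$ with $v_i\in H^{s+i}_{t+i}(S^{m-i}\mathbb R^n)$ and $v_i$ divergence-free for $i<m$, then for all $\ell_1,\dots,\ell_{n-1}\ge0$ with $\ell_1+\dots+\ell_{n-1}=m-\ell_n$, $$\mathcal R^m_{\ell_1\dots\ell_n}f=\mathcal R^m_{\ell_1\dots\ell_n}\big(d^{\ell_n}v_{\ell_n}\big),$$ and all of these transforms vanish if and only if $v_{\ell_n}=0$. -/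

import Mathlib

open MeasureTheory Filter Topology Real
open scoped SchwartzMap FourierTransform LineDeriv ENNReal Nat

noncomputable section

namespace TensorRadon

/-- Euclidean space of dimension `n`. -/
abbrev E (n : ℕ) : Type := EuclideanSpace ℝ (Fin n)

/-! ### The Fourier transform on Schwartz functions -/

/-- The unitary Fourier transform, with kernel `(2π)^(-n/2) e^(-i x·y)`. -/
def fourierHat {n : ℕ} (f : 𝓢(E n, ℂ)) (y : E n) : ℂ :=
  (((2 * π) ^ (-(n : ℝ) / 2) : ℝ) : ℂ) *
    ∫ x : E n, Complex.exp (-Complex.I * ((inner ℝ x y : ℝ) : ℂ)) * f x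

theorem fourierHat_eq {n : ℕ} (f : 𝓢(E n, ℂ)) (y : E n) :
    fourierHat f y = (((2 * π) ^ (-(n : ℝ) / 2) : ℝ) : ℂ) * (𝓕 f) ((2 * π)⁻¹ • y) := by
  rw [fourierHat, SchwartzMap.fourier_coe, Real.fourier_eq]
  congr 1
  refine integral_congr_ae (ae_of_all _ fun x => ?_)
  simp only [Circle.smul_def, Real.fourierChar_apply, smul_eq_mul, inner_smul_right]
  congr 2
  push_cast
  have : (π : ℂ) ≠ 0 := by exact_mod_cast Real.pi_ne_zero
  field_simp

theorem fourierHat_add {n : ℕ} (f g : 𝓢(E n, ℂ)) :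
    fourierHat (f + g) = fourierHat f + fourierHat g := by
  ext y
  simp [fourierHat_eq, FourierTransform.fourier_add, mul_add]

theorem fourierHat_smul {n : ℕ} (c : ℂ) (f : 𝓢(E n, ℂ)) :
    fourierHat (c • f) = c • fourierHat f := by
  ext y
  simp [fourierHat_eq, FourierTransform.fourier_smul]
  ring

theorem continuous_fourierHat {n : ℕ} (f : 𝓢(E n, ℂ)) : Continuous (fourierHat f) := by
  have : fourierHat f = fun y => (((2 * π) ^ (-(n : ℝ) / 2) : ℝ) : ℂ) *
      (𝓕 f) ((2 * π)⁻¹ • y) := funext (fourierHat_eq f)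
  rw [this]
  exact continuous_const.mul ((𝓕 f).continuous.comp (continuous_const_smul _))

theorem fourierHat_lineDeriv {n : ℕ} (f : 𝓢(E n, ℂ)) (a y : E n) :
    fourierHat (∂_{a} f) y = Complex.I * ((inner ℝ y a : ℝ) : ℂ) * fourierHat f y := by
  have ht : (inner ℝ · a : E n → ℝ).HasTemperateGrowth := by fun_prop
  rw [fourierHat_eq, fourierHat_eq, SchwartzMap.fourier_lineDerivOp_eq]
  simp [ht, inner_smul_left]
  have : (π : ℂ) ≠ 0 := by exact_mod_cast Real.pi_ne_zero
  field_simp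

/-! ### The weighted Sobolev spaces -/

/-- `|y|^t (1+|y|²)^((s-t)/2)`, the square root of the weight `|y|^(2t) (1+|y|²)^(s-t)`. -/
def rootWeight {n : ℕ} (s t : ℝ) (y : E n) : ℝ :=
  ‖y‖ ^ t * (1 + ‖y‖ ^ 2) ^ ((s - t) / 2)

theorem rootWeight_nonneg {n : ℕ} (s t : ℝ) (y : E n) : 0 ≤ rootWeight s t y := by
  unfold rootWeight; positivity

theorem measurable_rootWeight {n : ℕ} (s t : ℝ) : Measurable (rootWeight s t : E n → ℝ) := by
  unfold rootWeight; fun_prop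

/-- The function `|y|^t (1+|y|²)^((s-t)/2) f^(y)`, whose `L²` norm is the `H^s_t` norm of `f`. -/
def weightedHat {n : ℕ} (s t : ℝ) (f : 𝓢(E n, ℂ)) (y : E n) : ℂ :=
  (rootWeight s t y : ℂ) * fourierHat f y

theorem weightedHat_add {n : ℕ} (s t : ℝ) (f g : 𝓢(E n, ℂ)) :
    weightedHat s t (f + g) = weightedHat s t f + weightedHat s t g := by
  ext y; simp [weightedHat, fourierHat_add, mul_add]

theorem weightedHat_smul {n : ℕ} (s t : ℝ) (c : ℂ) (f : 𝓢(E n, ℂ)) :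
    weightedHat s t (c • f) = c • weightedHat s t f := by
  ext y; simp [weightedHat, fourierHat_smul]; ring

theorem measurable_weightedHat {n : ℕ} (s t : ℝ) (f : 𝓢(E n, ℂ)) :
    Measurable (weightedHat s t f) :=
  (Complex.measurable_ofReal.comp (measurable_rootWeight s t)).mul
    (continuous_fourierHat f).measurable

/-- The Schwartz functions of finite `H^s_t` norm (all of them as soon as `t > -n/2`, see
`mem_schwartzSobolev`). -/
def schwartzSobolev (n : ℕ) (s t : ℝ) : Submodule ℂ 𝓢(E n, ℂ) where
  carrier := {f | MemLp (weightedHat s t f) 2 volume}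
  add_mem' {f g} hf hg := by
    change MemLp _ _ _
    rw [weightedHat_add]; exact MemLp.add hf hg
  zero_mem' := by
    change MemLp _ _ _
    have h0 := weightedHat_smul (n := n) s t 0 0
    rw [zero_smul, zero_smul] at h0
    rw [h0]; exact MemLp.zero
  smul_mem' c f hf := by
    change MemLp _ _ _
    rw [weightedHat_smul]; exact MemLp.const_smul hf c

/-- The space of Schwartz functions of finite `H^s_t` norm, to be equipped with that norm (and not
with the topology of Schwartz space). -/
def PreSobolev (n : ℕ) (s t : ℝ) : Type := schwartzSobolev n s t

instance (n : ℕ) (s t : ℝ) : AddCommGroup (PreSobolev n s t) :=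
  inferInstanceAs (AddCommGroup (schwartzSobolev n s t))

instance (n : ℕ) (s t : ℝ) : Module ℂ (PreSobolev n s t) :=
  inferInstanceAs (Module ℂ (schwartzSobolev n s t))

/-- The underlying Schwartz function. -/
def PreSobolev.toSchwartz {n : ℕ} {s t : ℝ} : PreSobolev n s t →ₗ[ℂ] 𝓢(E n, ℂ) :=
  (schwartzSobolev n s t).subtype

/-- A Schwartz function of finite norm, as an element of `PreSobolev`. -/
def PreSobolev.mk {n : ℕ} {s t : ℝ} (f : 𝓢(E n, ℂ)) (hf : f ∈ schwartzSobolev n s t) :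
    PreSobolev n s t := ⟨f, hf⟩

@[simp] theorem PreSobolev.toSchwartz_mk {n : ℕ} {s t : ℝ} (f : 𝓢(E n, ℂ))
    (hf : f ∈ schwartzSobolev n s t) : (PreSobolev.mk f hf).toSchwartz = f := rfl

theorem PreSobolev.ext {n : ℕ} {s t : ℝ} {f g : PreSobolev n s t}
    (h : f.toSchwartz = g.toSchwartz) : f = g := Subtype.ext h

theorem PreSobolev.memLp {n : ℕ} {s t : ℝ} (f : PreSobolev n s t) :
    MemLp (weightedHat s t f.toSchwartz) 2 volume := f.2

/-- `f ↦ |y|^t (1+|y|²)^((s-t)/2) f^(y)` as a linear map into `L²`. -/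
def PreSobolev.toL2 (n : ℕ) (s t : ℝ) :
    PreSobolev n s t →ₗ[ℂ] Lp ℂ 2 (volume : Measure (E n)) where
  toFun f := f.memLp.toLp
  map_add' f g := by
    rw [← MemLp.toLp_add]
    simp only [map_add, weightedHat_add]
  map_smul' c f := by
    rw [RingHom.id_apply, ← MemLp.toLp_const_smul]
    simp only [map_smul, weightedHat_smul]

theorem PreSobolev.toL2_coe {n : ℕ} {s t : ℝ} (f : PreSobolev n s t) :
    PreSobolev.toL2 n s t f =ᵐ[volume] weightedHat s t f.toSchwartz := f.memLp.coeFn_toLp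

instance (n : ℕ) (s t : ℝ) : SeminormedAddCommGroup (PreSobolev n s t) :=
  SeminormedAddCommGroup.induced _ _ (PreSobolev.toL2 n s t)

instance (n : ℕ) (s t : ℝ) : NormedSpace ℂ (PreSobolev n s t) :=
  NormedSpace.induced ℂ _ _ (PreSobolev.toL2 n s t)

theorem PreSobolev.norm_def {n : ℕ} {s t : ℝ} (f : PreSobolev n s t) :
    ‖f‖ = ‖PreSobolev.toL2 n s t f‖ := rfl

theorem rootWeight_sq {n : ℕ} (s t : ℝ) (y : E n) :
    rootWeight s t y ^ 2 = ‖y‖ ^ (2 * t) * (1 + ‖y‖ ^ 2) ^ (s - t) := by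
  rw [rootWeight, mul_pow, ← Real.rpow_mul_natCast (by positivity),
    ← Real.rpow_mul_natCast (by positivity)]
  congr 2 <;> push_cast <;> ring

/-- The norm of `H^s_t`. -/
theorem PreSobolev.norm_sq {n : ℕ} {s t : ℝ} (f : PreSobolev n s t) :
    ‖f‖ ^ 2 = ∫ y : E n, ‖y‖ ^ (2 * t) * (1 + ‖y‖ ^ 2) ^ (s - t) *
      ‖fourierHat f.toSchwartz y‖ ^ 2 := by
  have h : ‖f‖ ^ 2 = RCLike.re (inner ℂ (PreSobolev.toL2 n s t f) (PreSobolev.toL2 n s t f)) := by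
    rw [PreSobolev.norm_def]; exact norm_sq_eq_re_inner _
  rw [h, L2.inner_def, ← integral_re (L2.integrable_inner _ _)]
  refine integral_congr_ae ?_
  filter_upwards [f.toL2_coe] with y hy
  rw [hy, ← norm_sq_eq_re_inner, weightedHat, norm_mul, Complex.norm_real,
    Real.norm_of_nonneg (rootWeight_nonneg s t y), ← rootWeight_sq, mul_pow]

/-- For `t > -n/2` every Schwartz function has finite `H^s_t` norm. -/
theorem mem_schwartzSobolev {n : ℕ} (hn : 0 < n) {s t : ℝ} (ht : -(n : ℝ) / 2 < t)
    (f : 𝓢(E n, ℂ)) : f ∈ schwartzSobolev n s t := by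
  change MemLp (weightedHat s t f) 2 volume
  have hme := (measurable_weightedHat s t f).aestronglyMeasurable (μ := volume)
  obtain ⟨N, hN⟩ := exists_nat_ge (|t| + |(s - t) / 2|)
  -- a Schwartz function dominating away from the origin
  let L : E n ≃L[ℝ] E n :=
    ContinuousLinearEquiv.smulLeft (Units.mk0 ((2 * π)⁻¹ : ℝ) (by positivity))
  let c : ℂ := (((2 * π) ^ (-(n : ℝ) / 2) : ℝ) : ℂ)
  let g : 𝓢(E n, ℂ) := c • SchwartzMap.compCLMOfContinuousLinearEquiv ℂ L (𝓕 f)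
  have hg : ∀ y, g y = fourierHat f y := fun y => by
    rw [fourierHat_eq]; rfl
  have hP : (fun y : E n => (((1 + ‖y‖ ^ 2) ^ N : ℝ) : ℂ)).HasTemperateGrowth := by
    fun_prop
  let k : 𝓢(E n, ℂ) := SchwartzMap.smulLeftCLM ℂ (fun y : E n => (((1 + ‖y‖ ^ 2) ^ N : ℝ) : ℂ)) g
  have hk : ∀ y, k y = (((1 + ‖y‖ ^ 2) ^ N : ℝ) : ℂ) * fourierHat f y := fun y => by
    rw [← hg]; exact SchwartzMap.smulLeftCLM_apply_apply hP g y
  rw [memLp_two_iff_integrable_sq_norm hme]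
  rw [← integrableOn_univ, ← Set.union_compl_self (Metric.ball (0 : E n) 1)]
  refine IntegrableOn.union ?_ ?_
  · obtain ⟨C, hC⟩ : ∃ C, ∀ y : E n, ‖y‖ ≤ 1 →
        (1 + ‖y‖ ^ 2) ^ (s - t) * ‖fourierHat f y‖ ^ 2 ≤ C := by
      have hc : Continuous fun y : E n => (1 + ‖y‖ ^ 2) ^ (s - t) * ‖fourierHat f y‖ ^ 2 := by
        refine Continuous.mul ?_ ((continuous_fourierHat f).norm.pow 2)
        exact Continuous.rpow_const (by fun_prop) (fun y => Or.inl (by positivity))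
      obtain ⟨C, hC⟩ := (isCompact_closedBall (0 : E n) 1).bddAbove_image hc.continuousOn
      exact ⟨C, fun y hy => hC ⟨y, by simpa using hy, rfl⟩⟩
    refine integrableOn_ball_of_norm_le_rpow (C := C) (α := -(2 * t)) (by simpa using Nat.succ_le_of_lt hn)
      (by simp; linarith) ?_ (hme.norm.pow 2)
    filter_upwards [ae_restrict_mem Metric.isOpen_ball.measurableSet] with y hy
    have hy1 : ‖y‖ ≤ 1 := (mem_ball_zero_iff.1 hy).le
    rw [Real.norm_of_nonneg (by positivity), weightedHat, norm_mul, mul_pow, Complex.norm_real,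
      Real.norm_of_nonneg (rootWeight_nonneg s t y), rootWeight_sq, neg_neg, mul_assoc, mul_comm]
    exact mul_le_mul_of_nonneg_right (hC y hy1) (by positivity)
  · have hk2 : IntegrableOn (fun y => ‖k y‖ ^ 2) (Metric.ball (0 : E n) 1)ᶜ :=
      ((memLp_two_iff_integrable_sq_norm k.continuous.aestronglyMeasurable).1
        (k.memLp 2)).integrableOn
    refine Integrable.mono' hk2 (hme.norm.pow 2).restrict ?_
    filter_upwards [ae_restrict_mem Metric.isOpen_ball.measurableSet.compl] with y hy
    have hy1 : 1 ≤ ‖y‖ := by simpa using hy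
    rw [Real.norm_of_nonneg (by positivity), hk, weightedHat, norm_mul, norm_mul,
      Complex.norm_real, Complex.norm_real, Real.norm_of_nonneg (rootWeight_nonneg s t y),
      Real.norm_of_nonneg (by positivity)]
    refine pow_le_pow_left₀ (mul_nonneg (rootWeight_nonneg _ _ _) (norm_nonneg _)) (mul_le_mul_of_nonneg_right ?_ (norm_nonneg _)) 2
    have hb : 1 ≤ 1 + ‖y‖ ^ 2 := by nlinarith
    have hyb : ‖y‖ ≤ 1 + ‖y‖ ^ 2 := by nlinarith
    calc rootWeight s t y ≤ ‖y‖ ^ |t| * (1 + ‖y‖ ^ 2) ^ |(s - t) / 2| :=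
          mul_le_mul (Real.rpow_le_rpow_of_exponent_le hy1 (le_abs_self t))
            (Real.rpow_le_rpow_of_exponent_le hb (le_abs_self _))
            (Real.rpow_nonneg (by positivity) _) (Real.rpow_nonneg (norm_nonneg _) _)
      _ ≤ (1 + ‖y‖ ^ 2) ^ |t| * (1 + ‖y‖ ^ 2) ^ |(s - t) / 2| := by gcongr
      _ = (1 + ‖y‖ ^ 2) ^ (|t| + |(s - t) / 2|) := (Real.rpow_add (by positivity) _ _).symm
      _ ≤ (1 + ‖y‖ ^ 2) ^ (N : ℝ) := Real.rpow_le_rpow_of_exponent_le hb hN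
      _ = (1 + ‖y‖ ^ 2) ^ N := Real.rpow_natCast _ _

/-- The Hilbert space `H^s_t(ℝⁿ)`: the completion of the Schwartz functions for the `H^s_t` norm. -/
abbrev Sobolev (n : ℕ) (s t : ℝ) : Type := UniformSpace.Completion (PreSobolev n s t)

theorem norm_weightedHat_lineDeriv_le {n : ℕ} {s t s' t' : ℝ} (hs : s' + 1 = s) (ht : t' + 1 = t)
    (j : Fin n) (f : 𝓢(E n, ℂ)) (y : E n) :
    ‖weightedHat s' t' (∂_{EuclideanSpace.single j (1 : ℝ)} f) y‖ ≤ ‖weightedHat s t f y‖ := by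
  subst hs ht
  rw [weightedHat, weightedHat, fourierHat_lineDeriv]
  simp only [norm_mul, Complex.norm_real, Complex.norm_I, one_mul,
    Real.norm_of_nonneg (rootWeight_nonneg _ _ _)]
  rw [← mul_assoc]
  refine mul_le_mul_of_nonneg_right ?_ (norm_nonneg _)
  have h1 : ‖(inner ℝ y (EuclideanSpace.single j (1 : ℝ)) : ℝ)‖ ≤ ‖y‖ := by
    simpa using norm_inner_le_norm (𝕜 := ℝ) y (EuclideanSpace.single j (1 : ℝ))
  refine (mul_le_mul_of_nonneg_left h1 (rootWeight_nonneg _ _ _)).trans ?_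
  rcases eq_or_ne y 0 with rfl | hy
  · simpa using rootWeight_nonneg _ _ _
  · have hy' : 0 < ‖y‖ := norm_pos_iff.2 hy
    rw [rootWeight, rootWeight, Real.rpow_add hy', Real.rpow_one]
    apply le_of_eq
    rw [show s' + 1 - (t' + 1) = s' - t' by ring]
    ring

theorem lineDeriv_mem {n : ℕ} {s t s' t' : ℝ} (hs : s' + 1 = s) (ht : t' + 1 = t)
    (j : Fin n) {f : 𝓢(E n, ℂ)} (hf : f ∈ schwartzSobolev n s t) :
    ∂_{EuclideanSpace.single j (1 : ℝ)} f ∈ schwartzSobolev n s' t' := by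
  exact MemLp.mono (g := weightedHat s t f) hf (measurable_weightedHat s' t' _).aestronglyMeasurable
    (ae_of_all _ (norm_weightedHat_lineDeriv_le hs ht j f))

/-- The partial derivative `∂_j` on Schwartz functions, as a bounded map for the Sobolev norms. -/
def prePartial {n : ℕ} {s t s' t' : ℝ} (hs : s' + 1 = s) (ht : t' + 1 = t) (j : Fin n) :
    PreSobolev n s t →L[ℂ] PreSobolev n s' t' :=
  LinearMap.mkContinuous
    { toFun := fun f => PreSobolev.mk (∂_{EuclideanSpace.single j (1 : ℝ)} f.toSchwartz)
        (lineDeriv_mem hs ht j f.memLp)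
      map_add' := fun f g => PreSobolev.ext (by simp [LineDeriv.lineDerivOp_add])
      map_smul' := fun c f => PreSobolev.ext (by simp [LineDeriv.lineDerivOp_smul]) }
    1 (fun f => by
      rw [one_mul, PreSobolev.norm_def, PreSobolev.norm_def]
      refine Lp.norm_le_norm_of_ae_le ?_
      filter_upwards [f.toL2_coe, PreSobolev.toL2_coe (PreSobolev.mk _
        (lineDeriv_mem hs ht j f.memLp))] with y h1 h2
      rw [h1]
      refine (le_of_eq (congrArg norm h2)).trans ?_
      exact norm_weightedHat_lineDeriv_le hs ht j f.toSchwartz y)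

/-- The partial derivative `∂_j : H^s_t → H^(s-1)_(t-1)`, extended from Schwartz functions by
continuity. The orders are tied by equations, so that no casts are needed when it is iterated. -/
def partialDeriv {n : ℕ} {s t s' t' : ℝ} (hs : s' + 1 = s) (ht : t' + 1 = t) (j : Fin n) :
    Sobolev n s t →L[ℂ] Sobolev n s' t' :=
  (prePartial hs ht j).completion

/-! ### Symmetric tensors -/

section Sym

variable {V W : Type*} [AddCommGroup V] [Module ℂ V] [AddCommGroup W] [Module ℂ W]

/-- Symmetric `m`-tensors on `ℝⁿ` whose components lie in `V`. With `V` a space of functions these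
are the symmetric `m`-tensor fields with components in that space. -/
def SymTensor (m n : ℕ) (V : Type*) [AddCommGroup V] [Module ℂ V] :
    Submodule ℂ ((Fin m → Fin n) → V) where
  carrier := {u | ∀ (τ : Equiv.Perm (Fin m)) (I : Fin m → Fin n), u (I ∘ τ) = u I}
  add_mem' hu hv τ I := by simp [hu τ I, hv τ I]
  zero_mem' _ _ := rfl
  smul_mem' c u hu τ I := by simp [hu τ I]

/-- Apply a linear map to every component. -/
def SymTensor.map {m n : ℕ} (L : V →ₗ[ℂ] W) (u : SymTensor m n V) : SymTensor m n W :=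
  ⟨fun I => L (u.1 I), fun τ I => congrArg L (u.2 τ I)⟩

/-- Read a tensor of order `k` as one of order `m` when `k = m`. -/
def SymTensor.cast {k m n : ℕ} (h : k = m) (u : SymTensor k n V) : SymTensor m n V :=
  h ▸ u

/-- The symmetrization `σ`. -/
def symmetrize {m n : ℕ} (u : (Fin m → Fin n) → V) : SymTensor m n V :=
  ⟨fun I => ((m ! : ℂ)⁻¹) • ∑ τ : Equiv.Perm (Fin m), u (I ∘ τ), fun ρ I => by
    have h : ∑ τ : Equiv.Perm (Fin m), u ((I ∘ ρ) ∘ τ) = ∑ τ : Equiv.Perm (Fin m), u (I ∘ τ) :=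
      Fintype.sum_equiv (Equiv.mulLeft ρ) _ _ (fun _ => rfl)
    exact congrArg (fun v => ((m ! : ℂ)⁻¹) • v) h⟩

end Sym

/-- The inner differentiation `d`: the symmetrization of
`(i_1, …, i_(k+1)) ↦ ∂u_(i_1 … i_k) / ∂x_(i_(k+1))`. -/
def innerDeriv {n k : ℕ} {s t s' t' : ℝ} (hs : s' + 1 = s) (ht : t' + 1 = t)
    (u : SymTensor k n (Sobolev n s t)) : SymTensor (k + 1) n (Sobolev n s' t') :=
  symmetrize fun I => partialDeriv hs ht (I (Fin.last k)) (u.1 (Fin.init I))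

/-- The iterate `d^i`, from order `k` and class `H^(s+i)_(t+i)` to order `k + i` and class
`H^s_t`. -/
def innerDerivIter {n k : ℕ} : (i : ℕ) → {s t s' t' : ℝ} → s' + (i : ℝ) = s → t' + (i : ℝ) = t →
    SymTensor k n (Sobolev n s t) → SymTensor (k + i) n (Sobolev n s' t')
  | 0, _, _, _, _, hs, ht, u =>
      (show _ = _ by simpa using hs) ▸ (show _ = _ by simpa using ht) ▸ u
  | i + 1, _, _, s', t', hs, ht, u =>
      innerDeriv (s := s' + 1) (t := t' + 1) rfl rfl
        (innerDerivIter i (by rw [← hs]; push_cast; ring) (by rw [← ht]; push_cast; ring) u)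

/-- The term `d^i v` of order `m`, for `v` of order `m - i` and class `H^(s+i)_(t+i)`. -/
def potential {n m : ℕ} {s t : ℝ} (i : Fin (m + 1))
    (v : SymTensor (m - i) n (Sobolev n (s + (i : ℕ)) (t + (i : ℕ)))) :
    SymTensor m n (Sobolev n s t) :=
  SymTensor.cast (Nat.sub_add_cancel i.is_le) (innerDerivIter (i : ℕ) rfl rfl v)

/-- The divergence `(δu)_(i_1 … i_k) = Σ_j ∂u_(i_1 … i_k j) / ∂x_j`. -/
def divergence {n k : ℕ} {s t s' t' : ℝ} (hs : s' + 1 = s) (ht : t' + 1 = t)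
    (u : SymTensor (k + 1) n (Sobolev n s t)) : (Fin k → Fin n) → Sobolev n s' t' :=
  fun I => ∑ j : Fin n, partialDeriv hs ht j (u.1 (Fin.snoc (α := fun _ => Fin n) I j))

/-- `u` is divergence-free (solenoidal); no condition in order zero. -/
def IsDivergenceFree {n : ℕ} {s t : ℝ} : {k : ℕ} → SymTensor k n (Sobolev n s t) → Prop
  | 0, _ => True
  | _ + 1, u => divergence (sub_add_cancel s 1) (sub_add_cancel t 1) u = 0

/-! ### The generalized Radon transform -/

/-- A measurable choice, for each unit vector `ω` of `ℝ^(d+1)`, of an orthonormal basis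
`ω_1, …, ω_d, ω` whose last member is `ω`. -/
structure Frame (d : ℕ) where
  basis : Metric.sphere (0 : E (d + 1)) 1 → OrthonormalBasis (Fin (d + 1)) ℝ (E (d + 1))
  basis_last : ∀ ω, basis ω (Fin.last d) = ω
  measurable_basis : ∀ j, Measurable fun ω => basis ω j

/-- The symmetric product `a_1 ⊙ ⋯ ⊙ a_m`, in components. -/
def symProd {m n : ℕ} (a : Fin m → E n) (I : Fin m → Fin n) : ℝ :=
  ((m ! : ℝ)⁻¹) * ∑ τ : Equiv.Perm (Fin m), ∏ k, a (τ k) (I k)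

/-- The list of `m` vectors in which `b_1` occurs `ℓ_1` times, then `b_2` occurs `ℓ_2` times, and
so on. -/
def repeated {m n : ℕ} (b : Fin n → E n) (ℓ : Fin n → ℕ) (hℓ : ∑ j, ℓ j = m) (k : Fin m) : E n :=
  b (finSigmaFinEquiv.symm (Fin.cast hℓ.symm k)).1

/-- The generalized Radon transform of a symmetric Schwartz tensor field: the integral over the
hyperplane `pω + ω^⊥` of `⟨f, ω_1^(⊙ ℓ_1) ⊙ ⋯ ⊙ ω_d^(⊙ ℓ_d) ⊙ ω^(⊙ ℓ_(d+1))⟩`. -/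
def schwartzRadon {d m : ℕ} (F : Frame d) (ℓ : Fin (d + 1) → ℕ) (hℓ : ∑ j, ℓ j = m)
    (f : SymTensor m (d + 1) 𝓢(E (d + 1), ℂ)) (ω : Metric.sphere (0 : E (d + 1)) 1) (p : ℝ) : ℂ :=
  ∫ y : (Submodule.span ℝ {(ω : E (d + 1))})ᗮ, ∑ I : Fin m → Fin (d + 1),
    f.1 I (p • (ω : E (d + 1)) + (y : E (d + 1))) *
      (symProd (repeated (F.basis ω) ℓ hℓ) I : ℂ)

/-- The Fourier transform in the variable `p`. -/
def hatP (g : ℝ → ℂ) (σ : ℝ) : ℂ :=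
  (((2 * π) ^ (-(1 / 2 : ℝ)) : ℝ) : ℂ) * ∫ p : ℝ, Complex.exp (-Complex.I * (p * σ : ℝ)) * g p

/-- The squared norm of `H^s_t(S^d × ℝ)`, of a function given through its Fourier transform `G`
in `p`. -/
def sphereNormSq {d : ℕ} (s t : ℝ) (G : Metric.sphere (0 : E (d + 1)) 1 → ℝ → ℂ) : ℝ≥0∞ :=
  ENNReal.ofReal (1 / (2 * (2 * π) ^ d)) *
    ∫⁻ ω, (∫⁻ σ : ℝ, ENNReal.ofReal (|σ| ^ (2 * t) * (1 + |σ| ^ 2) ^ (s - t) * ‖G ω σ‖ ^ 2))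
      ∂(volume : Measure (E (d + 1))).toSphere

/-- The generalized Radon transform of `f ∈ H^s_t(S^m ℝ^(d+1))`, obtained from the transform of
Schwartz tensor fields by density: an element of the completion `H^(s+d/2)_(t+d/2)(S^d × ℝ)` is
given by its Fourier transform `G` in `p`, a function in a weighted `L²` space, and `G` represents
the transform of `f` when the transforms of Schwartz fields `g` converge to it as `g → f` in
`H^s_t`. -/
def IsRadon {d m : ℕ} (F : Frame d) (ℓ : Fin (d + 1) → ℕ) (hℓ : ∑ j, ℓ j = m) {s t : ℝ}
    (f : SymTensor m (d + 1) (Sobolev (d + 1) s t))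
    (G : Metric.sphere (0 : E (d + 1)) 1 → ℝ → ℂ) : Prop :=
  Measurable (Function.uncurry G) ∧
  Tendsto (fun g : SymTensor m (d + 1) (PreSobolev (d + 1) s t) =>
      sphereNormSq (s + (d : ℝ) / 2) (t + (d : ℝ) / 2) fun ω σ =>
        hatP (schwartzRadon F ℓ hℓ (SymTensor.map PreSobolev.toSchwartz g) ω) σ - G ω σ)
    (comap (SymTensor.map (UniformSpace.Completion.toComplL (𝕜 := ℂ)
      (E := PreSobolev (d + 1) s t)).toLinearMap) (𝓝 f)) (𝓝 0)

/-- The generalized Radon transform of `f` vanishes. -/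
def RadonVanishes {d m : ℕ} (F : Frame d) (ℓ : Fin (d + 1) → ℕ) (hℓ : ∑ j, ℓ j = m) {s t : ℝ}
    (f : SymTensor m (d + 1) (Sobolev (d + 1) s t)) : Prop :=
  IsRadon F ℓ hℓ f 0

end TensorRadon

end

/-! The Fourier transform turns everything into pointwise linear algebra. Multiplication by the
square root of the weight identifies every `H^s_t` with the same space `L²(ℝⁿ)` (`norm_wHat`,
`wHat_surjective`). Since `∂_j` lowers both orders by one, it becomes multiplication by the bounded
symbol `i y_j / |y|` (`wHat_partialDeriv`). Identities between tensor fields are then identities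
between symmetric tensors at almost every frequency `y`.

A symmetric tensor is encoded by a homogeneous polynomial. Take as variables `X_1, …, X_n` the
coordinates in an orthonormal basis whose last vector is `±y/|y|`. Then `d` is multiplication by `±i
X_n`, and being divergence-free means not involving `X_n`. Writing `f = Σ d^i v_i` is therefore
sorting monomials by their exponent of `X_n`. Stripping off `(i X_n)^i` costs no integrability,
because the scalar `i` has modulus one, and the measurable frame makes the pieces measurable
(`exists_eq_sum_potential`).

By the Fourier slice theorem (`hatP_schwartzRadon`), the transform at `(ω, σ)` is a constant times
the pairing of the Fourier transform of `f` at `σω` with a symmetric product of frame vectors. Up to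
a nonzero counting factor this pairing is the coefficient of the monomial with exponents `ℓ`. Fixing
the last exponent to be `r` isolates exactly the part coming from `v_r`, and all these coefficients
together determine it (`forall_pairing_value_sum_potential_iff`).

It remains to treat the extension by density. Polar coordinates express the norm on the sphere times
the line as an `L²` norm over frequencies (`sphereNormSq_radonHat`). This gives a bound, hence a
continuous extension with an explicit formula (`isRadon_iff`). Each `y ≠ 0` is reached twice, from
`y/|y|` and from `-y/|y|`, and the frames at antipodal points are unrelated, so the vanishing
criterion `radonVanishes_iff` carries two pairings. -/

noncomputable section

namespace TensorRadon

/-! ### Symmetric tensors as homogeneous polynomials -/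

section Algebra

variable {m k n d : ℕ}

/-- The polynomial `Σ_I T_I X_(I 1) ⋯ X_(I m)` of a tensor. -/
def tensorPoly (T : (Fin m → Fin n) → ℂ) : MvPolynomial (Fin n) ℂ :=
  ∑ I, MvPolynomial.C (T I) * ∏ k, MvPolynomial.X (I k)

/-- The exponent of the monomial `X_(J 1) ⋯ X_(J m)`. -/
def indexType (J : Fin m → Fin n) : Fin n →₀ ℕ := ∑ k, Finsupp.single (J k) 1

theorem indexType_apply (J : Fin m → Fin n) (j : Fin n) :
    indexType J j = Fintype.card {k // J k = j} := by
  classical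
  simp [indexType, Finsupp.finsetSum_apply, Finsupp.single_apply, Fintype.card_subtype]

theorem degree_indexType (J : Fin m → Fin n) : (indexType J).degree = m := by
  simp [indexType]

/-- Equal types mean that corresponding fibres have equal cardinality; bijections between the fibres
glue to a permutation. -/
theorem exists_perm_of_indexType_eq {J J' : Fin m → Fin n} (h : indexType J = indexType J') :
    ∃ τ : Equiv.Perm (Fin m), J' ∘ τ = J := by
  have e : ∀ j, Nonempty ({k // J k = j} ≃ {k // J' k = j}) := fun j => by
    rw [← Fintype.card_eq, ← indexType_apply, ← indexType_apply, h]
  exact ⟨Equiv.ofFiberEquiv fun j => (e j).some, funext fun k => Equiv.ofFiberEquiv_map _ k⟩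

theorem coeff_tensorPoly (T : (Fin m → Fin n) → ℂ) (e : Fin n →₀ ℕ) :
    (tensorPoly T).coeff e = ∑ J, if indexType J = e then T J else 0 := by
  classical
  rw [tensorPoly, MvPolynomial.coeff_sum]
  refine Finset.sum_congr rfl fun J _ => ?_
  have : ∏ k, (MvPolynomial.X (J k) : MvPolynomial (Fin n) ℂ) =
      MvPolynomial.monomial (indexType J) 1 := by
    rw [indexType, MvPolynomial.monomial_sum_one]; rfl
  rw [this, MvPolynomial.coeff_C_mul, MvPolynomial.coeff_monomial]
  split_ifs <;> simp

/-- The number of multi-indices of a given type. -/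
def typeCount (m : ℕ) (e : Fin n →₀ ℕ) : ℕ :=
  Fintype.card {J : Fin m → Fin n // indexType J = e}

theorem typeCount_ne_zero (J : Fin m → Fin n) : (typeCount m (indexType J) : ℂ) ≠ 0 := by
  rw [Nat.cast_ne_zero, typeCount]
  have : Nonempty {J' : Fin m → Fin n // indexType J' = indexType J} := ⟨⟨J, rfl⟩⟩
  exact Fintype.card_ne_zero

/-- A symmetric tensor is constant on the multi-indices of a given type, so collecting like
monomials only multiplies by their number. As that number is nonzero, the polynomial determines the
tensor. -/
theorem coeff_tensorPoly_indexType {T : (Fin m → Fin n) → ℂ}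
    (hT : ∀ (τ : Equiv.Perm (Fin m)) I, T (I ∘ τ) = T I) (J : Fin m → Fin n) :
    (tensorPoly T).coeff (indexType J) = typeCount m (indexType J) * T J := by
  classical
  rw [coeff_tensorPoly]
  have : ∀ J', (if indexType J' = indexType J then T J' else 0) =
      if indexType J' = indexType J then T J else 0 := fun J' => by
    split_ifs with h
    · obtain ⟨τ, rfl⟩ := exists_perm_of_indexType_eq h
      exact hT τ J
    · rfl
  simp_rw [this]
  rw [← Finset.sum_filter, Finset.sum_const, nsmul_eq_mul, typeCount, Fintype.card_subtype]

theorem coeff_tensorPoly_of_degree_ne (T : (Fin m → Fin n) → ℂ) {e : Fin n →₀ ℕ}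
    (he : e.degree ≠ m) : (tensorPoly T).coeff e = 0 := by
  rw [coeff_tensorPoly]
  refine Finset.sum_eq_zero fun J _ => if_neg ?_
  rintro rfl
  exact he (degree_indexType J)

/-- The variables commute, so permuting the indices does not change the polynomial. Hence the
symmetrization in the definition of `d` disappears at this level. -/
theorem tensorPoly_symmetrize (u : (Fin m → Fin n) → ℂ) :
    tensorPoly (symmetrize u).1 = tensorPoly u := by
  have hm : ((m ! : ℕ) : ℂ) ≠ 0 := by exact_mod_cast Nat.factorial_ne_zero m
  have key : ∀ τ : Equiv.Perm (Fin m), tensorPoly (fun I => u (I ∘ τ)) = tensorPoly u := fun τ => by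
    refine Fintype.sum_equiv (τ.symm.arrowCongr (Equiv.refl _)) _ _ fun I => ?_
    have h : ((τ.symm.arrowCongr (Equiv.refl _)) I : Fin m → Fin n) = I ∘ τ := rfl
    rw [h]
    congr 1
    exact (Equiv.prod_comp τ fun k => (MvPolynomial.X (I k) : MvPolynomial (Fin n) ℂ)).symm
  have : tensorPoly (symmetrize u).1 =
      MvPolynomial.C ((m ! : ℂ)⁻¹) * ∑ τ : Equiv.Perm (Fin m), tensorPoly (fun I => u (I ∘ τ)) := by
    simp only [tensorPoly, symmetrize, smul_eq_mul, map_mul, map_sum]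
    rw [Finset.sum_comm, Finset.mul_sum]
    simp only [Finset.sum_mul, Finset.mul_sum, mul_assoc]
  rw [this]
  simp only [key, Finset.sum_const, Finset.card_univ, Fintype.card_perm, Fintype.card_fin]
  rw [nsmul_eq_mul, ← mul_assoc, ← map_natCast MvPolynomial.C, ← map_mul, inv_mul_cancel₀ hm]
  simp

/-- This is what makes `d` a multiplication operator: appending an index weighted by `c` multiplies
the polynomial by the linear form with coefficients `c`. -/
theorem tensorPoly_mul_last (c : Fin n → ℂ) (T : (Fin k → Fin n) → ℂ) :
    tensorPoly (fun I : Fin (k + 1) → Fin n => c (I (Fin.last k)) * T (Fin.init I)) =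
      (∑ j, MvPolynomial.C (c j) * MvPolynomial.X j) * tensorPoly T := by
  rw [tensorPoly, ← Equiv.sum_comp (Fin.snocEquiv fun _ : Fin (k + 1) => Fin n),
    Fintype.sum_prod_type, tensorPoly, Finset.sum_mul_sum]
  refine Finset.sum_congr rfl fun j _ => Finset.sum_congr rfl fun I _ => ?_
  have h : Fin.init ((Fin.snocEquiv fun _ : Fin (k + 1) => Fin n) (j, I)) = I :=
    Fin.init_snoc (α := fun _ => Fin n) j I
  rw [h]
  simp only [Fin.snocEquiv_apply, Fin.snoc_last, Fin.prod_univ_castSucc,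
    Fin.snoc_castSucc, map_mul]
  ring

theorem tensorPoly_add (T S : (Fin m → Fin n) → ℂ) :
    tensorPoly (T + S) = tensorPoly T + tensorPoly S := by
  simp [tensorPoly, add_mul, Finset.sum_add_distrib]

/-- The components of a tensor in an orthonormal basis. -/
def rotate (b : OrthonormalBasis (Fin n) ℝ (E n)) (T : (Fin m → Fin n) → ℂ)
    (J : Fin m → Fin n) : ℂ :=
  ∑ I, T I * ∏ k, (b (J k) (I k) : ℂ)

/-- The tensor with prescribed components in an orthonormal basis. -/
def unrotate (b : OrthonormalBasis (Fin n) ℝ (E n)) (S : (Fin m → Fin n) → ℂ)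
    (I : Fin m → Fin n) : ℂ :=
  ∑ J, S J * ∏ k, (b (J k) (I k) : ℂ)

theorem sum_basis_mul_basis (b : OrthonormalBasis (Fin n) ℝ (E n)) (j k : Fin n) :
    ∑ i, (b j i : ℂ) * (b k i : ℂ) = if j = k then 1 else 0 := by
  have h := orthonormal_iff_ite.1 b.orthonormal j k
  rw [PiLp.inner_apply] at h
  simp only [RCLike.inner_apply, conj_trivial] at h
  rw [← Complex.ofReal_one, ← Complex.ofReal_zero, ← apply_ite Complex.ofReal,
    ← h]
  push_cast
  exact Finset.sum_congr rfl fun _ _ => mul_comm _ _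

theorem sum_basis_mul_basis' (b : OrthonormalBasis (Fin n) ℝ (E n)) (i j : Fin n) :
    ∑ k, (b k i : ℂ) * (b k j : ℂ) = if i = j then 1 else 0 := by
  have h := b.sum_inner_mul_inner (EuclideanSpace.single j 1) (EuclideanSpace.single i 1)
  simp only [EuclideanSpace.inner_single_left, EuclideanSpace.inner_single_right, map_one, one_mul,
    conj_trivial, PiLp.single_apply] at h
  rw [← Complex.ofReal_one, ← Complex.ofReal_zero, ← apply_ite Complex.ofReal, ← h]
  push_cast
  exact Finset.sum_congr rfl fun _ _ => mul_comm _ _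

theorem prod_ite_eq_comp (I J : Fin m → Fin n) :
    (∏ k, if I k = J k then (1 : ℂ) else 0) = if I = J then 1 else 0 := by
  classical
  rw [Finset.prod_ite_zero]
  simp [funext_iff]

theorem rotate_unrotate (b : OrthonormalBasis (Fin n) ℝ (E n)) (S : (Fin m → Fin n) → ℂ) :
    rotate b (unrotate b S) = S := by
  ext J
  simp only [rotate, unrotate, Finset.sum_mul]
  rw [Finset.sum_comm]
  have : ∀ J', ∑ I : Fin m → Fin n, S J' * (∏ k, (b (J' k) (I k) : ℂ)) * ∏ k, (b (J k) (I k) : ℂ) =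
      S J' * if J' = J then 1 else 0 := fun J' => by
    rw [← prod_ite_eq_comp]
    simp_rw [← sum_basis_mul_basis b, mul_assoc, ← Finset.mul_sum, ← Finset.prod_mul_distrib]
    rw [Finset.prod_univ_sum, Fintype.piFinset_univ]
  simp [this]

theorem unrotate_rotate (b : OrthonormalBasis (Fin n) ℝ (E n)) (T : (Fin m → Fin n) → ℂ) :
    unrotate b (rotate b T) = T := by
  ext I
  simp only [rotate, unrotate, Finset.sum_mul]
  rw [Finset.sum_comm]
  have : ∀ I', ∑ J : Fin m → Fin n, T I' * (∏ k, (b (J k) (I' k) : ℂ)) * ∏ k, (b (J k) (I k) : ℂ) =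
      T I' * if I' = I then 1 else 0 := fun I' => by
    rw [← prod_ite_eq_comp]
    simp_rw [← sum_basis_mul_basis' b, mul_assoc, ← Finset.mul_sum, ← Finset.prod_mul_distrib]
    rw [Finset.prod_univ_sum, Fintype.piFinset_univ]
  simp [this]

theorem rotate_comp_perm (b : OrthonormalBasis (Fin n) ℝ (E n)) {T : (Fin m → Fin n) → ℂ}
    (hT : ∀ (τ : Equiv.Perm (Fin m)) I, T (I ∘ τ) = T I) (τ : Equiv.Perm (Fin m))
    (J : Fin m → Fin n) : rotate b T (J ∘ τ) = rotate b T J := by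
  refine (Fintype.sum_equiv (τ.symm.arrowCongr (Equiv.refl _)) _ _ fun I => ?_).symm
  have h : ((τ.symm.arrowCongr (Equiv.refl _)) I : Fin m → Fin n) = I ∘ τ := rfl
  rw [h, hT]
  congr 1
  exact (Equiv.prod_comp τ fun k => (b (J k) (I k) : ℂ)).symm

/-- The polynomial of a tensor in the coordinates of an orthonormal basis. -/
def rotPoly (b : OrthonormalBasis (Fin n) ℝ (E n)) (T : (Fin m → Fin n) → ℂ) :
    MvPolynomial (Fin n) ℂ :=
  MvPolynomial.bind₁ (fun j => ∑ k, MvPolynomial.C (b k j : ℂ) * MvPolynomial.X k) (tensorPoly T)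

/-- Expanding the linear substitution into a product of sums produces the components in the basis
`b` as coefficients. -/
theorem rotPoly_eq (b : OrthonormalBasis (Fin n) ℝ (E n)) (T : (Fin m → Fin n) → ℂ) :
    rotPoly b T = tensorPoly (rotate b T) := by
  simp only [rotPoly, tensorPoly, map_sum, map_mul, MvPolynomial.bind₁_C_right, map_prod,
    MvPolynomial.bind₁_X_right, rotate, Finset.sum_mul]
  rw [Finset.sum_comm]
  refine Finset.sum_congr rfl fun I _ => ?_
  rw [Finset.prod_univ_sum, Fintype.piFinset_univ, Finset.mul_sum]
  refine Finset.sum_congr rfl fun J _ => ?_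
  rw [Finset.prod_mul_distrib, mul_assoc]

theorem rotPoly_add (b : OrthonormalBasis (Fin n) ℝ (E n)) (T S : (Fin m → Fin n) → ℂ) :
    rotPoly b (T + S) = rotPoly b T + rotPoly b S := by
  rw [rotPoly, tensorPoly_add, map_add]; rfl

theorem rotPoly_injective (b : OrthonormalBasis (Fin n) ℝ (E n)) {T : (Fin m → Fin n) → ℂ}
    (hT : ∀ (τ : Equiv.Perm (Fin m)) I, T (I ∘ τ) = T I) (h : rotPoly b T = 0) : T = 0 := by
  have hr : rotate b T = 0 := funext fun J => by
    have h1 := coeff_tensorPoly_indexType (rotate_comp_perm b hT) J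
    rw [← rotPoly_eq, h, MvPolynomial.coeff_zero] at h1
    exact (mul_eq_zero.1 h1.symm).resolve_left (typeCount_ne_zero J)
  rw [← unrotate_rotate b T, hr]
  ext I; simp [unrotate]

/-- By orthonormality, the linear form dual to the last basis vector becomes the last variable
alone. In adapted coordinates the symbol of `d` is thus a monomial. -/
theorem bind_linear (b : OrthonormalBasis (Fin (d + 1)) ℝ (E (d + 1))) (c : ℂ) :
    MvPolynomial.bind₁ (fun j => ∑ k, MvPolynomial.C (b k j : ℂ) * MvPolynomial.X k)
      (∑ j, MvPolynomial.C (c * (b (Fin.last d) j : ℂ)) * MvPolynomial.X j) =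
      MvPolynomial.C c * MvPolynomial.X (Fin.last d) := by
  simp only [map_sum, map_mul, MvPolynomial.bind₁_C_right, MvPolynomial.bind₁_X_right,
    Finset.mul_sum]
  rw [Finset.sum_comm]
  have : ∀ k, ∑ j, MvPolynomial.C c * MvPolynomial.C (b (Fin.last d) j : ℂ) *
      (MvPolynomial.C (b k j : ℂ) * MvPolynomial.X k) =
      MvPolynomial.C c * (MvPolynomial.C (if Fin.last d = k then 1 else 0) * MvPolynomial.X k) :=
    fun k => by
      rw [← sum_basis_mul_basis b, map_sum, Finset.sum_mul, Finset.mul_sum]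
      refine Finset.sum_congr rfl fun j _ => ?_
      rw [map_mul]; ring
  simp [this, apply_ite, ite_mul]

/-! ### The pairing of the Radon transform -/

/-- `⟨T, b_1^(⊙ ℓ_1) ⊙ ⋯ ⊙ b_n^(⊙ ℓ_n)⟩`. -/
def pairing (b : Fin n → E n) (ℓ : Fin n → ℕ) (hℓ : ∑ j, ℓ j = m) (T : (Fin m → Fin n) → ℂ) : ℂ :=
  ∑ I, T I * (symProd (repeated b ℓ hℓ) I : ℂ)

/-- Pairing with a symmetric tensor does not see the order of the factors, so the average over
permutations collapses to one product. -/
theorem sum_mul_symProd {T : (Fin m → Fin n) → ℂ}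
    (hT : ∀ (τ : Equiv.Perm (Fin m)) I, T (I ∘ τ) = T I) (a : Fin m → E n) :
    ∑ I, T I * (symProd a I : ℂ) = ∑ I, T I * ∏ k, (a k (I k) : ℂ) := by
  have hm : ((m ! : ℕ) : ℂ) ≠ 0 := by exact_mod_cast Nat.factorial_ne_zero m
  have key : ∀ τ : Equiv.Perm (Fin m), ∑ I, T I * ∏ k, (a (τ k) (I k) : ℂ) =
      ∑ I, T I * ∏ k, (a k (I k) : ℂ) := fun τ => by
    refine (Fintype.sum_equiv (τ.symm.arrowCongr (Equiv.refl _)) _ _ fun I => ?_).symm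
    have h : ((τ.symm.arrowCongr (Equiv.refl _)) I : Fin m → Fin n) = I ∘ τ := rfl
    rw [h, hT]
    congr 1
    exact (Equiv.prod_comp τ fun k => (a k (I k) : ℂ)).symm
  have : ∑ I, T I * (symProd a I : ℂ) =
      (m ! : ℂ)⁻¹ * ∑ τ : Equiv.Perm (Fin m), ∑ I, T I * ∏ k, (a (τ k) (I k) : ℂ) := by
    rw [Finset.sum_comm, Finset.mul_sum]
    refine Finset.sum_congr rfl fun I _ => ?_
    rw [symProd, ← Finset.mul_sum]
    push_cast
    ring
  rw [this]
  simp only [key, Finset.sum_const, Finset.card_univ, Fintype.card_perm, Fintype.card_fin,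
    nsmul_eq_mul]
  rw [← mul_assoc, inv_mul_cancel₀ hm, one_mul]

/-- The nondecreasing multi-index in which `j` occurs `ℓ j` times. -/
def sortedIndex (ℓ : Fin n → ℕ) (hℓ : ∑ j, ℓ j = m) (k : Fin m) : Fin n :=
  (finSigmaFinEquiv.symm (Fin.cast hℓ.symm k)).1

theorem indexType_sortedIndex (ℓ : Fin n → ℕ) (hℓ : ∑ j, ℓ j = m) (j : Fin n) :
    indexType (sortedIndex ℓ hℓ) j = ℓ j := by
  subst hℓ
  rw [indexType_apply, ← Fintype.card_fin (ℓ j)]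
  refine Fintype.card_congr ?_
  refine (Equiv.subtypeEquiv (q := fun x : (i : Fin n) × Fin (ℓ i) => x.1 = j)
    finSigmaFinEquiv.symm fun a => by simp [sortedIndex]).trans ?_
  exact Equiv.sigmaSubtype j 

theorem pairing_eq {b : OrthonormalBasis (Fin n) ℝ (E n)} {T : (Fin m → Fin n) → ℂ}
    (hT : ∀ (τ : Equiv.Perm (Fin m)) I, T (I ∘ τ) = T I) (ℓ : Fin n → ℕ) (hℓ : ∑ j, ℓ j = m) :
    pairing b ℓ hℓ T = rotate b T (sortedIndex ℓ hℓ) :=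
  sum_mul_symProd hT _

/-- Each pairing is the component of `T` at a sorted multi-index, hence a nonzero multiple of one
coefficient of the rotated polynomial. Every exponent of degree `m` arises from a sorted
multi-index, and coefficients of other degrees vanish anyway. -/
theorem forall_pairing_eq_zero_iff {b : OrthonormalBasis (Fin (d + 1)) ℝ (E (d + 1))}
    {T : (Fin m → Fin (d + 1)) → ℂ} (hT : ∀ (τ : Equiv.Perm (Fin m)) I, T (I ∘ τ) = T I) (r : ℕ) :
    (∀ (ℓ : Fin (d + 1) → ℕ) (hℓ : ∑ j, ℓ j = m), ℓ (Fin.last d) = r → pairing b ℓ hℓ T = 0) ↔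
      ∀ e : Fin (d + 1) →₀ ℕ, e (Fin.last d) = r → (rotPoly b T).coeff e = 0 := by
  constructor
  · intro h e he
    by_cases hm : e.degree = m
    · have hℓ : ∑ j, e j = m := by rw [← hm, Finsupp.degree_eq_sum]
      have ht : indexType (sortedIndex e hℓ) = e := Finsupp.ext (indexType_sortedIndex e hℓ)
      rw [rotPoly_eq, ← ht, coeff_tensorPoly_indexType (rotate_comp_perm b hT), ← pairing_eq hT,
        h e hℓ he, mul_zero]
    · rw [rotPoly_eq, coeff_tensorPoly_of_degree_ne _ hm]
  · intro h ℓ hℓ hr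
    have h1 := coeff_tensorPoly_indexType (rotate_comp_perm b hT) (sortedIndex ℓ hℓ)
    rw [← rotPoly_eq, h _ ((indexType_sortedIndex ℓ hℓ _).trans hr)] at h1
    rw [pairing_eq hT]
    exact (mul_eq_zero.1 h1.symm).resolve_left (typeCount_ne_zero _)

/-! ### Contraction with the last basis vector -/

/-- The contraction with the last basis vector collects the components whose final index is the last
one. By symmetry, any occurrence of that index can be moved to the final slot, so every monomial
containing the last variable has coefficient zero. -/
theorem coeff_rotPoly_of_contraction_eq_zero {b : OrthonormalBasis (Fin (d + 1)) ℝ (E (d + 1))}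
    {T : (Fin (k + 1) → Fin (d + 1)) → ℂ} (hT : ∀ (τ : Equiv.Perm (Fin (k + 1))) I, T (I ∘ τ) = T I)
    (h : ∀ I : Fin k → Fin (d + 1),
      ∑ j, (b (Fin.last d) j : ℂ) * T (Fin.snoc (α := fun _ => Fin (d + 1)) I j) = 0)
    {e : Fin (d + 1) →₀ ℕ} (he : e (Fin.last d) ≠ 0) : (rotPoly b T).coeff e = 0 := by
  have hlast : ∀ J : Fin (k + 1) → Fin (d + 1), J (Fin.last k) = Fin.last d → rotate b T J = 0 := by
    intro J hJ
    rw [rotate, ← Equiv.sum_comp (Fin.snocEquiv fun _ : Fin (k + 1) => Fin (d + 1)),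
      Fintype.sum_prod_type, Finset.sum_comm]
    refine Finset.sum_eq_zero fun I _ => ?_
    have hs : ∀ j, (Fin.snocEquiv fun _ : Fin (k + 1) => Fin (d + 1)) (j, I) =
      Fin.snoc (α := fun _ => Fin (d + 1)) I j := fun _ => rfl
    simp only [hs, Fin.prod_univ_castSucc, Fin.snoc_castSucc, Fin.snoc_last, hJ]
    rw [← mul_zero (∏ x : Fin k, (b (J x.castSucc) (I x) : ℂ)), ← h I, Finset.mul_sum]
    exact Finset.sum_congr rfl fun j _ => by ring
  rw [rotPoly_eq, coeff_tensorPoly]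
  refine Finset.sum_eq_zero fun J _ => ?_
  split_ifs with hJ
  · rw [← hJ, indexType_apply] at he
    obtain ⟨⟨i, hi⟩⟩ : Nonempty {i // J i = Fin.last d} := by
      by_contra hne
      rw [not_nonempty_iff] at hne
      exact he Fintype.card_eq_zero
    rw [← rotate_comp_perm b hT (Equiv.swap i (Fin.last k))]
    exact hlast _ (by simp [hi])
  · rfl

/-- Converse direction: contraction with a basis vector selects, by orthonormality, the components
that have this vector in the final slot. -/
theorem contraction_unrotate_eq_zero {b : OrthonormalBasis (Fin (d + 1)) ℝ (E (d + 1))}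
    {S : (Fin (k + 1) → Fin (d + 1)) → ℂ} (hS : ∀ J, J (Fin.last k) = Fin.last d → S J = 0)
    (I : Fin k → Fin (d + 1)) :
    ∑ j, (b (Fin.last d) j : ℂ) *
      unrotate b S (Fin.snoc (α := fun _ => Fin (d + 1)) I j) = 0 := by
  simp only [unrotate, Finset.mul_sum]
  rw [Finset.sum_comm]
  refine Finset.sum_eq_zero fun J _ => ?_
  simp only [Fin.prod_univ_castSucc, Fin.snoc_castSucc, Fin.snoc_last]
  have : ∀ j, (b (Fin.last d) j : ℂ) * (S J * ((∏ x : Fin k, (b (J x.castSucc) (I x) : ℂ)) *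
      (b (J (Fin.last k)) j : ℂ))) = S J * (∏ x : Fin k, (b (J x.castSucc) (I x) : ℂ)) *
      ((b (Fin.last d) j : ℂ) * (b (J (Fin.last k)) j : ℂ)) := fun j => by ring
  simp only [this]
  rw [← Finset.mul_sum, sum_basis_mul_basis]
  split_ifs with h
  · rw [hS J h.symm]; simp
  · simp

/-! ### The decomposition of a tensor along the last basis vector -/

/-- The components, in the basis `b`, of the part of `T` which is of degree `r` in the last basis
vector, with the factors of the last basis vector removed. -/
def partAlong (b : OrthonormalBasis (Fin (d + 1)) ℝ (E (d + 1))) (c : ℂ) (T : (Fin m → Fin (d + 1)) → ℂ)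
    (k r : ℕ) (J : Fin k → Fin (d + 1)) : ℂ :=
  if indexType J (Fin.last d) = 0 then
    (c ^ r)⁻¹ * (typeCount k (indexType J) : ℂ)⁻¹ *
      (tensorPoly (rotate b T)).coeff (indexType J + Finsupp.single (Fin.last d) r)
  else 0

theorem indexType_comp_perm (J : Fin m → Fin n) (τ : Equiv.Perm (Fin m)) :
    indexType (J ∘ τ) = indexType J :=
  Equiv.sum_comp τ fun k => Finsupp.single (J k) 1

theorem partAlong_comp_perm (b : OrthonormalBasis (Fin (d + 1)) ℝ (E (d + 1))) (c : ℂ)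
    (T : (Fin m → Fin (d + 1)) → ℂ) (k r : ℕ) (τ : Equiv.Perm (Fin k)) (J : Fin k → Fin (d + 1)) :
    partAlong b c T k r (J ∘ τ) = partAlong b c T k r J := by
  simp only [partAlong, indexType_comp_perm]

theorem unrotate_comp_perm (b : OrthonormalBasis (Fin n) ℝ (E n)) {S : (Fin m → Fin n) → ℂ}
    (hS : ∀ (τ : Equiv.Perm (Fin m)) I, S (I ∘ τ) = S I) (τ : Equiv.Perm (Fin m))
    (I : Fin m → Fin n) : unrotate b S (I ∘ τ) = unrotate b S I := by
  refine (Fintype.sum_equiv (τ.symm.arrowCongr (Equiv.refl _)) _ _ fun J => ?_).symm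
  have h : ((τ.symm.arrowCongr (Equiv.refl _)) J : Fin m → Fin n) = J ∘ τ := rfl
  rw [h, hS]
  congr 1
  exact (Equiv.prod_comp τ fun k => (b (J k) (I k) : ℂ)).symm

/-- The normalizing factors in `partAlong` are chosen for this formula: dividing by `typeCount`
undoes the multiplicity with which a component enters its coefficient, and `(c ^ r)⁻¹` anticipates
the later multiplication by `(c X)^r`. -/
theorem coeff_tensorPoly_partAlong (b : OrthonormalBasis (Fin (d + 1)) ℝ (E (d + 1))) (c : ℂ)
    (T : (Fin m → Fin (d + 1)) → ℂ) (k r : ℕ) (e : Fin (d + 1) →₀ ℕ) :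
    (tensorPoly (partAlong b c T k r)).coeff e =
      if e (Fin.last d) = 0 ∧ e.degree = k then
        (c ^ r)⁻¹ * (tensorPoly (rotate b T)).coeff (e + Finsupp.single (Fin.last d) r) else 0 := by
  by_cases hk : e.degree = k
  · have hℓ : ∑ j, e j = k := by rw [← hk, Finsupp.degree_eq_sum]
    have ht : indexType (sortedIndex e hℓ) = e := Finsupp.ext (indexType_sortedIndex e hℓ)
    rw [← ht, coeff_tensorPoly_indexType (partAlong_comp_perm b c T k r), partAlong, ht]
    have h0 := typeCount_ne_zero (sortedIndex e hℓ)
    rw [ht] at h0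
    simp only [hk, and_true]
    split_ifs
    · field_simp
    · simp
  · rw [coeff_tensorPoly_of_degree_ne _ hk, if_neg (by tauto)]

/-- The monomials of `T` are sorted by their exponent of the last variable: a monomial `e` receives
a contribution only from the index `r` equal to that exponent. -/
theorem sum_partAlong (b : OrthonormalBasis (Fin (d + 1)) ℝ (E (d + 1))) {c : ℂ} (hc : c ≠ 0)
    (T : (Fin m → Fin (d + 1)) → ℂ) :
    ∑ r : Fin (m + 1), (MvPolynomial.C c * MvPolynomial.X (Fin.last d)) ^ (r : ℕ) *
      rotPoly b (unrotate b (partAlong b c T (m - r) r)) = rotPoly b T := by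
  ext e
  simp only [rotPoly_eq, rotate_unrotate]
  rw [MvPolynomial.coeff_sum]
  have hterm : ∀ r : Fin (m + 1), ((MvPolynomial.C c * MvPolynomial.X (Fin.last d)) ^ (r : ℕ) *
      tensorPoly (partAlong b c T (m - r) r)).coeff e =
      if (r : ℕ) = e (Fin.last d) then (tensorPoly (rotate b T)).coeff e else 0 := by
    intro r
    rw [mul_pow, ← map_pow, mul_assoc, MvPolynomial.coeff_C_mul, MvPolynomial.X_pow_eq_monomial,
      MvPolynomial.coeff_monomial_mul']
    by_cases hle : Finsupp.single (Fin.last d) (r : ℕ) ≤ e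
    · rw [if_pos hle, coeff_tensorPoly_partAlong, tsub_add_cancel_of_le hle]
      have h1 : (e - Finsupp.single (Fin.last d) (r : ℕ)) (Fin.last d) = e (Fin.last d) - r := by
        simp
      have h2 := congrArg Finsupp.degree (tsub_add_cancel_of_le hle)
      rw [map_add, Finsupp.degree_single] at h2
      have h3 : (r : ℕ) ≤ e (Fin.last d) := by simpa using hle (Fin.last d)
      rw [h1]
      have h4 := r.is_le
      by_cases hr : (r : ℕ) = e (Fin.last d)
      · by_cases hm : e.degree = m
        · rw [if_pos ⟨by omega, by omega⟩, if_pos hr]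
          field_simp
        · rw [if_neg (by omega), if_pos hr, coeff_tensorPoly_of_degree_ne _ hm]
          simp
      · rw [if_neg (by omega), if_neg hr]; simp
    · rw [if_neg hle, if_neg, mul_zero]
      intro hr
      rw [hr] at hle
      exact hle (by simp)
  simp only [hterm]
  by_cases hm : e.degree = m
  · have hlt : e (Fin.last d) < m + 1 := by
      have := Finsupp.le_degree (Fin.last d) e
      omega
    rw [Finset.sum_eq_single ⟨_, hlt⟩]
    · simp
    · intro r _ hr
      rw [if_neg fun h => hr (Fin.ext h)]
    · simp
  · simp [coeff_tensorPoly_of_degree_ne _ hm]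

/-- The coefficients of degree `r` in the last variable of `Σ_i (c X)^i q_i`, where the `q_i` do not
involve the last variable `X`. -/
theorem coeff_sum_pow_mul {c : ℂ} (q : Fin (m + 1) → MvPolynomial (Fin (d + 1)) ℂ)
    (hq : ∀ i e, e (Fin.last d) ≠ 0 → (q i).coeff e = 0) (r : Fin (m + 1))
    {e : Fin (d + 1) →₀ ℕ} (he : e (Fin.last d) = r) :
    (∑ i : Fin (m + 1), (MvPolynomial.C c * MvPolynomial.X (Fin.last d)) ^ (i : ℕ) * q i).coeff e =
      c ^ (r : ℕ) * (q r).coeff (e - Finsupp.single (Fin.last d) (r : ℕ)) := by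
  have hterm : ∀ i : Fin (m + 1), ((MvPolynomial.C c * MvPolynomial.X (Fin.last d)) ^ (i : ℕ) *
      q i).coeff e = if Finsupp.single (Fin.last d) (i : ℕ) ≤ e then
        c ^ (i : ℕ) * (q i).coeff (e - Finsupp.single (Fin.last d) (i : ℕ)) else 0 := by
    intro i
    rw [mul_pow, ← map_pow, mul_assoc, MvPolynomial.coeff_C_mul, MvPolynomial.X_pow_eq_monomial,
      MvPolynomial.coeff_monomial_mul']
    simp
  rw [MvPolynomial.coeff_sum, Finset.sum_eq_single r]
  · rw [hterm, if_pos (by simp [he])]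
  · intro i _ hi
    rw [hterm]
    split_ifs with hle
    · have h3 : (i : ℕ) ≤ e (Fin.last d) := by simpa using hle (Fin.last d)
      have h4 : (i : ℕ) ≠ r := fun h => hi (Fin.ext h)
      -- Here `i < r`, so after removing `X^i` the last variable still has positive exponent `r -
      -- i`, and it does not occur in `q i`.
      rw [hq, mul_zero]
      simp
      omega
    · rfl
  · simp

end Algebra

end TensorRadon

namespace TensorRadon

/-! ### The Sobolev spaces as `L²` -/

section Hat

variable {n : ℕ} {s t : ℝ}

/-- The weighted Fourier transform as a linear isometry into `L²`. -/
def PreSobolev.toL2Isometry (n : ℕ) (s t : ℝ) :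
    PreSobolev n s t →ₗᵢ[ℂ] Lp ℂ 2 (volume : Measure (E n)) :=
  ⟨PreSobolev.toL2 n s t, fun _ => rfl⟩

/-- The weighted Fourier transform `|y|^t (1+|y|²)^((s-t)/2) f^(y)` on `H^s_t`. -/
def wHat : Sobolev n s t →L[ℂ] Lp ℂ 2 (volume : Measure (E n)) :=
  (PreSobolev.toL2Isometry n s t).toContinuousLinearMap.extend UniformSpace.Completion.toComplL

theorem wHat_coe (f : PreSobolev n s t) :
    wHat (f : Sobolev n s t) = PreSobolev.toL2 n s t f :=
  ContinuousLinearMap.extend_eq _ (e := UniformSpace.Completion.toComplL)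
    UniformSpace.Completion.denseRange_coe
    (UniformSpace.Completion.isUniformInducing_coe _) f

theorem norm_wHat (f : Sobolev n s t) : ‖wHat f‖ = ‖f‖ := by
  induction f using UniformSpace.Completion.induction_on with
  | hp => exact isClosed_eq (by fun_prop) (by fun_prop)
  | ih f => rw [wHat_coe, UniformSpace.Completion.norm_coe]; rfl

theorem wHat_injective : Function.Injective (wHat : Sobolev n s t → _) :=
  (AddMonoidHomClass.isometry_of_norm (wHat : Sobolev n s t →L[ℂ] _) norm_wHat).injective

theorem rootWeight_pos {y : E n} (hy : y ≠ 0) : 0 < rootWeight s t y := by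
  have := norm_pos_iff.2 hy
  unfold rootWeight; positivity

/-- The weight may be singular or vanish at the origin only; elsewhere a bump function can be
divided by it without losing smoothness. -/
theorem contDiffAt_rootWeight_inv {y : E n} (hy : y ≠ 0) :
    ContDiffAt ℝ ((⊤ : ℕ∞) : WithTop ℕ∞) (fun y : E n => (rootWeight s t y)⁻¹) y := by
  refine ContDiffAt.inv ?_ (rootWeight_pos hy).ne'
  unfold rootWeight
  refine ContDiffAt.mul ?_ ?_
  · exact (contDiffAt_norm ℝ hy).rpow_const_of_ne (norm_ne_zero_iff.2 hy)
  · refine ContDiffAt.rpow_const_of_ne (contDiffAt_const.add (contDiff_norm_sq ℝ).contDiffAt) ?_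
    positivity

/-- Every Schwartz function is a unitary Fourier transform. -/
theorem exists_fourierHat_eq (h : 𝓢(E n, ℂ)) : ∃ f : 𝓢(E n, ℂ), fourierHat f = h := by
  let L : E n ≃L[ℝ] E n :=
    ContinuousLinearEquiv.smulLeft (Units.mk0 ((2 * π) : ℝ) (by positivity))
  let c : ℂ := (((2 * π) ^ (-(n : ℝ) / 2) : ℝ) : ℂ)
  have hc : c ≠ 0 := by
    simp only [c, ne_eq, Complex.ofReal_eq_zero]
    positivity
  let g : 𝓢(E n, ℂ) := c⁻¹ • SchwartzMap.compCLMOfContinuousLinearEquiv ℂ L h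
  refine ⟨𝓕⁻ g, funext fun y => ?_⟩
  rw [fourierHat_eq, FourierTransform.fourier_fourierInv_eq]
  change c * (c⁻¹ * h ((2 * π) • (2 * π)⁻¹ • y)) = h y
  rw [smul_smul, mul_inv_cancel₀ (by positivity), one_smul, mul_inv_cancel_left₀ hc]

/-- Divide `ψ` by the weight and invert the Fourier transform. The support of `ψ` avoids the origin,
so the quotient is smooth with compact support, hence Schwartz, whatever the orders `s` and `t`. -/
theorem exists_weightedHat_eq {ψ : E n → ℝ} (hψ : ContDiff ℝ ((⊤ : ℕ∞) : WithTop ℕ∞) ψ) (hc : HasCompactSupport ψ)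
    (h0 : tsupport ψ ⊆ {0}ᶜ) : ∃ f : PreSobolev n s t, ∀ᵐ y,
      weightedHat s t f.toSchwartz y = ψ y := by
  let h : E n → ℂ := fun y => ((ψ y * (rootWeight s t y)⁻¹ : ℝ) : ℂ)
  have hsm : ContDiff ℝ ((⊤ : ℕ∞) : WithTop ℕ∞) h := by
    refine Complex.ofRealCLM.contDiff.comp (contDiff_iff_contDiffAt.2 fun y => ?_)
    by_cases hy : y ∈ tsupport ψ
    · exact hψ.contDiffAt.mul (contDiffAt_rootWeight_inv (h0 hy))
    · have : (fun y => ψ y * (rootWeight s t y)⁻¹) =ᶠ[𝓝 y] fun _ => 0 := by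
        filter_upwards [(isClosed_tsupport ψ).isOpen_compl.mem_nhds hy] with z hz
        rw [image_eq_zero_of_notMem_tsupport hz, zero_mul]
      exact contDiffAt_const.congr_of_eventuallyEq this
  have hcs : HasCompactSupport h := by
    refine hc.mono fun y hy => ?_
    contrapose! hy
    simp only [Function.mem_support, not_not] at hy
    simp [h, hy]
  obtain ⟨f, hf⟩ := exists_fourierHat_eq (hcs.toSchwartzMap hsm)
  have hw : ∀ y, weightedHat s t f y = ψ y := fun y => by
    rw [weightedHat, hf]
    change (rootWeight s t y : ℂ) * ((ψ y * (rootWeight s t y)⁻¹ : ℝ) : ℂ) = ψ y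
    by_cases hy : y = 0
    · have : ψ y = 0 := image_eq_zero_of_notMem_tsupport fun h => h0 h hy
      simp [this]
    · have := (rootWeight_pos (s := s) (t := t) hy).ne'
      rw [← Complex.ofReal_mul]
      congr 1
      field_simp
  refine ⟨PreSobolev.mk f ?_, ae_of_all _ hw⟩
  change MemLp (weightedHat s t f) 2 volume
  rw [show weightedHat s t f = fun y => (ψ y : ℂ) from funext hw]
  exact (Complex.continuous_ofReal.comp hψ.continuous).memLp_of_hasCompactSupport
    (hc.comp_left Complex.ofReal_zero)

theorem ae_ne_zero (hn : 0 < n) : ∀ᵐ y : E n, y ≠ 0 := by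
  have : Nonempty (Fin n) := ⟨⟨0, hn⟩⟩
  exact Measure.ae_ne volume 0

/-- The range is closed, being the isometric image of a complete space. A function orthogonal to it
is orthogonal to all test functions supported away from the origin, so it vanishes almost
everywhere. This is what allows fields to be constructed by prescribing their values at each
frequency. -/
theorem wHat_surjective (hn : 0 < n) : Function.Surjective (wHat : Sobolev n s t → _) := by
  have hiso := AddMonoidHomClass.isometry_of_norm (wHat : Sobolev n s t →L[ℂ] _) norm_wHat
  let K := LinearMap.range (wHat : Sobolev n s t →L[ℂ] _).toLinearMap
  have hclosed : IsClosed (K : Set (Lp ℂ 2 (volume : Measure (E n)))) :=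
    hiso.isClosedEmbedding.isClosed_range
  have hbot : Kᗮ = ⊥ := by
    rw [Submodule.eq_bot_iff]
    intro h hh
    rw [Submodule.mem_orthogonal] at hh
    have key : ∀ᵐ y, y ∈ ({0}ᶜ : Set (E n)) → h y = 0 := by
      refine isOpen_compl_singleton.ae_eq_zero_of_integral_contDiff_smul_eq_zero
        (((Lp.memLp h).locallyIntegrable (by norm_num)).locallyIntegrableOn _) fun ψ hψ hc h0 => ?_
      obtain ⟨f, hf⟩ := exists_weightedHat_eq (s := s) (t := t) hψ hc h0
      have h1 := hh _ ⟨(f : Sobolev n s t), rfl⟩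
      change inner ℂ (wHat (f : Sobolev n s t)) h = 0 at h1
      rw [wHat_coe, L2.inner_def] at h1
      rw [← h1]
      refine integral_congr_ae ?_
      filter_upwards [hf, f.toL2_coe] with y h2 h3
      rw [h3, h2]
      simp [mul_comm]
    refine Lp.ext ?_
    filter_upwards [key, ae_ne_zero hn, Lp.coeFn_zero ℂ 2 (volume : Measure (E n))] with y h1 h2 h3
    rw [h1 h2, h3]; rfl
  have htop : K = ⊤ := by
    rw [← hclosed.submodule_topologicalClosure_eq, Submodule.topologicalClosure_eq_top_iff]
    exact hbot
  exact LinearMap.range_eq_top.1 htop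

/-! ### Partial derivatives as bounded multipliers -/

theorem memLp_bdd_mul {ψ f : E n → ℂ} (hψ : Measurable ψ) {C : ℝ} (hb : ∀ y, ‖ψ y‖ ≤ C)
    (hf : MemLp f 2 volume) : MemLp (fun y => ψ y * f y) 2 volume :=
  (hf.const_mul (C : ℂ)).mono (hψ.aestronglyMeasurable.mul hf.1) (ae_of_all _ fun y => by
    rw [norm_mul, norm_mul, Complex.norm_real]
    exact mul_le_mul_of_nonneg_right ((hb y).trans (le_abs_self C)) (norm_nonneg _))

/-- The multiplier `i y_j / |y|` of a partial derivative. -/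
def multiplier (y : E n) (j : Fin n) : ℂ := Complex.I * ((y j / ‖y‖ : ℝ) : ℂ)

theorem measurable_multiplier (j : Fin n) : Measurable fun y : E n => multiplier y j := by
  unfold multiplier
  fun_prop

theorem norm_multiplier_le (y : E n) (j : Fin n) : ‖multiplier y j‖ ≤ 1 := by
  rw [multiplier, norm_mul, Complex.norm_I, one_mul, Complex.norm_real, norm_div, norm_norm]
  exact div_le_one_of_le₀ (PiLp.norm_apply_le y j) (norm_nonneg _)

/-- Multiplication by `i y_j / |y|` on `L²`. -/
def multiplierL2 (j : Fin n) :
    Lp ℂ 2 (volume : Measure (E n)) →L[ℂ] Lp ℂ 2 (volume : Measure (E n)) :=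
  LinearMap.mkContinuous
    { toFun := fun f => (memLp_bdd_mul (measurable_multiplier j)
        (fun y => norm_multiplier_le y j) (Lp.memLp f)).toLp
      map_add' := fun f g => by
        refine Lp.ext ?_
        filter_upwards [MemLp.coeFn_toLp (memLp_bdd_mul (measurable_multiplier j)
            (fun y => norm_multiplier_le y j) (Lp.memLp f)),
          MemLp.coeFn_toLp (memLp_bdd_mul (measurable_multiplier j)
            (fun y => norm_multiplier_le y j) (Lp.memLp g)),
          MemLp.coeFn_toLp (memLp_bdd_mul (measurable_multiplier j)
            (fun y => norm_multiplier_le y j) (Lp.memLp (f + g))), Lp.coeFn_add f g,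
          Lp.coeFn_add (MemLp.toLp _ (memLp_bdd_mul (measurable_multiplier j)
            (fun y => norm_multiplier_le y j) (Lp.memLp f))) (MemLp.toLp _ (memLp_bdd_mul
            (measurable_multiplier j) (fun y => norm_multiplier_le y j) (Lp.memLp g)))]
          with y h1 h2 h3 h4 h5
        rw [h3, h5, Pi.add_apply, h1, h2, h4, Pi.add_apply, mul_add]
      map_smul' := fun c f => by
        refine Lp.ext ?_
        filter_upwards [MemLp.coeFn_toLp (memLp_bdd_mul (measurable_multiplier j)
            (fun y => norm_multiplier_le y j) (Lp.memLp f)),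
          MemLp.coeFn_toLp (memLp_bdd_mul (measurable_multiplier j)
            (fun y => norm_multiplier_le y j) (Lp.memLp (c • f))), Lp.coeFn_smul c f,
          Lp.coeFn_smul c (MemLp.toLp _ (memLp_bdd_mul (measurable_multiplier j)
            (fun y => norm_multiplier_le y j) (Lp.memLp f)))]
          with y h1 h3 h4 h5
        rw [h3, RingHom.id_apply, h5, Pi.smul_apply, h1, h4, Pi.smul_apply, smul_eq_mul,
          smul_eq_mul]
        ring }
    1 (fun f => by
      rw [one_mul]
      refine Lp.norm_le_norm_of_ae_le ?_
      filter_upwards [MemLp.coeFn_toLp (memLp_bdd_mul (measurable_multiplier j)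
            (fun y => norm_multiplier_le y j) (Lp.memLp f))] with y h1
      refine (le_of_eq (congrArg norm h1)).trans ?_
      rw [norm_mul]
      exact mul_le_of_le_one_left (norm_nonneg _) (norm_multiplier_le y j))

theorem multiplierL2_coe (j : Fin n) (f : Lp ℂ 2 (volume : Measure (E n))) :
    multiplierL2 j f =ᵐ[volume] fun y => multiplier y j * f y :=
  MemLp.coeFn_toLp (memLp_bdd_mul (measurable_multiplier j)
    (fun y => norm_multiplier_le y j) (Lp.memLp f))

/-- Lowering both orders by one removes exactly one factor `|y|` from the root weight, which turns
`i y_j` into `i y_j / |y|`. -/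
theorem weightedHat_lineDeriv {s' t' : ℝ} (hs : s' + 1 = s) (ht : t' + 1 = t)
    (j : Fin n) (f : 𝓢(E n, ℂ)) {y : E n} (hy : y ≠ 0) :
    weightedHat s' t' (∂_{EuclideanSpace.single j (1 : ℝ)} f) y =
      multiplier y j * weightedHat s t f y := by
  subst hs ht
  have hy' : 0 < ‖y‖ := norm_pos_iff.2 hy
  have hw : rootWeight (s' + 1) (t' + 1) y = rootWeight s' t' y * ‖y‖ := by
    rw [rootWeight, rootWeight, Real.rpow_add hy', Real.rpow_one,
      show s' + 1 - (t' + 1) = s' - t' by ring]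
    ring
  have : (‖y‖ : ℂ) ≠ 0 := by exact_mod_cast hy'.ne'
  rw [weightedHat, weightedHat, fourierHat_lineDeriv, hw, multiplier,
    EuclideanSpace.inner_single_right]
  push_cast
  field_simp
  simp only [RCLike.conj_to_real]
  ring

theorem wHat_partialDeriv {s' t' : ℝ} (hn : 0 < n) (hs : s' + 1 = s) (ht : t' + 1 = t)
    (j : Fin n) (f : Sobolev n s t) :
    wHat (partialDeriv hs ht j f) = multiplierL2 j (wHat f) := by
  induction f using UniformSpace.Completion.induction_on with
  | hp => exact isClosed_eq (by fun_prop) (by fun_prop)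
  | ih f =>
    have h1 : partialDeriv hs ht j (f : Sobolev n s t) = (prePartial hs ht j f : Sobolev n s' t') :=
      UniformSpace.Completion.map_coe (prePartial hs ht j).uniformContinuous f
    rw [h1, wHat_coe, wHat_coe]
    refine Lp.ext ?_
    filter_upwards [f.toL2_coe, (prePartial hs ht j f).toL2_coe, ae_ne_zero hn,
      multiplierL2_coe j (PreSobolev.toL2 n s t f)] with y h2 h3 h4 h5
    rw [h3, h5, h2, ← weightedHat_lineDeriv hs ht j _ h4]
    rfl

end Hat

/-! ### Pointwise values of tensor fields -/

section Values

variable {n m k : ℕ} {s t : ℝ}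

/-- The weighted Fourier transform of a tensor field at a point. -/
def value (u : SymTensor m n (Sobolev n s t)) (y : E n) : (Fin m → Fin n) → ℂ :=
  fun I => wHat (u.1 I) y

theorem value_comp_perm (u : SymTensor m n (Sobolev n s t)) (y : E n) (τ : Equiv.Perm (Fin m))
    (I : Fin m → Fin n) : value u y (I ∘ τ) = value u y I := by
  rw [value, u.2 τ I]; rfl

theorem measurable_value (u : SymTensor m n (Sobolev n s t)) (I : Fin m → Fin n) :
    Measurable fun y => value u y I :=
  (Lp.stronglyMeasurable (wHat (u.1 I))).measurable

theorem value_add (u v : SymTensor m n (Sobolev n s t)) :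
    ∀ᵐ y, value (u + v) y = value u y + value v y := by
  have : ∀ I, ∀ᵐ y, value (u + v) y I = value u y I + value v y I := fun I => by
    filter_upwards [Lp.coeFn_add (wHat (u.1 I)) (wHat (v.1 I))] with y hy
    rw [value, show (u + v).1 I = u.1 I + v.1 I from rfl, map_add, hy]; rfl
  filter_upwards [ae_all_iff.2 this] with y hy
  exact funext hy

theorem value_sub (u v : SymTensor m n (Sobolev n s t)) :
    ∀ᵐ y, value (u - v) y = value u y - value v y := by
  filter_upwards [value_add (u - v) v] with y hy
  rw [sub_add_cancel] at hy
  rw [hy, add_sub_cancel_right]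

theorem value_zero : ∀ᵐ y, value (0 : SymTensor m n (Sobolev n s t)) y = 0 := by
  filter_upwards [Lp.coeFn_zero ℂ 2 (volume : Measure (E n))] with y hy
  ext I
  rw [value, show (0 : SymTensor m n (Sobolev n s t)).1 I = 0 from rfl, map_zero, hy]; rfl

theorem value_sum {ι : Type*} (S : Finset ι) (u : ι → SymTensor m n (Sobolev n s t)) :
    ∀ᵐ y, value (∑ i ∈ S, u i) y = ∑ i ∈ S, value (u i) y := by
  classical
  induction S using Finset.induction_on with
  | empty => simpa using value_zero
  | insert a S ha ih =>
    rw [Finset.sum_insert ha]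
    filter_upwards [ih, value_add (u a) (∑ i ∈ S, u i)] with y h1 h2
    rw [h2, h1, Finset.sum_insert ha]

theorem eq_of_value_ae_eq {u v : SymTensor m n (Sobolev n s t)}
    (h : ∀ᵐ y, value u y = value v y) : u = v := by
  refine Subtype.ext (funext fun I => wHat_injective (Lp.ext ?_))
  filter_upwards [h] with y hy
  exact congrFun hy I

/-- Every symmetric `L²` tensor field is the weighted Fourier transform of a field in `H^s_t`. -/
theorem exists_value_ae_eq (hn : 0 < n) {W : E n → (Fin m → Fin n) → ℂ}
    (hW : ∀ I, MemLp (fun y => W y I) 2 volume)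
    (hsymm : ∀ y (τ : Equiv.Perm (Fin m)) I, W y (I ∘ τ) = W y I) :
    ∃ u : SymTensor m n (Sobolev n s t), ∀ᵐ y, value u y = W y := by
  choose g hg using wHat_surjective (s := s) (t := t) hn
  refine ⟨⟨fun I => g ((hW I).toLp), fun τ I => ?_⟩, ?_⟩
  · refine congrArg g ?_
    exact MemLp.toLp_congr _ _ (ae_of_all _ fun y => hsymm y τ I)
  · have : ∀ I, ∀ᵐ y, wHat (g ((hW I).toLp)) y = W y I := fun I => by
      rw [hg]; exact (hW I).coeFn_toLp
    filter_upwards [ae_all_iff.2 this] with y hy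
    exact funext hy

/-- Almost everywhere, the value of `du` is the symmetrization of the symbol times the value of `u`;
passing to polynomials removes the symmetrization. -/
theorem tensorPoly_value_innerDeriv {s' t' : ℝ} (hn : 0 < n) (hs : s' + 1 = s) (ht : t' + 1 = t)
    (u : SymTensor k n (Sobolev n s t)) :
    ∀ᵐ y, tensorPoly (value (innerDeriv hs ht u) y) =
      (∑ j, MvPolynomial.C (multiplier y j) * MvPolynomial.X j) * tensorPoly (value u y) := by
  have h1 : ∀ (j : Fin n) (I : Fin k → Fin n), ∀ᵐ y,
      wHat (partialDeriv hs ht j (u.1 I)) y = multiplier y j * value u y I := fun j I => by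
    rw [wHat_partialDeriv hn]; exact multiplierL2_coe j _
  have h2 : ∀ I, ∀ᵐ y, value (innerDeriv hs ht u) y I =
      (symmetrize fun I : Fin (k + 1) → Fin n =>
        multiplier y (I (Fin.last k)) * value u y (Fin.init I)).1 I := fun I => by
    have h3 : wHat ((innerDeriv hs ht u).1 I) = (((k + 1) ! : ℂ)⁻¹) •
        ∑ τ : Equiv.Perm (Fin (k + 1)),
          wHat (partialDeriv hs ht ((I ∘ τ) (Fin.last k)) (u.1 (Fin.init (I ∘ τ)))) := by
      rw [← map_sum, ← map_smul]; rfl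
    have h4 : ∀ᵐ y, ∀ τ : Equiv.Perm (Fin (k + 1)),
        wHat (partialDeriv hs ht ((I ∘ τ) (Fin.last k)) (u.1 (Fin.init (I ∘ τ)))) y =
        multiplier y ((I ∘ τ) (Fin.last k)) * value u y (Fin.init (I ∘ τ)) :=
      ae_all_iff.2 fun τ => h1 _ _
    filter_upwards [h4, Lp.coeFn_smul (((k + 1) ! : ℂ)⁻¹) (∑ τ : Equiv.Perm (Fin (k + 1)),
          wHat (partialDeriv hs ht ((I ∘ τ) (Fin.last k)) (u.1 (Fin.init (I ∘ τ))))),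
      Lp.coeFn_finsetSum Finset.univ fun τ : Equiv.Perm (Fin (k + 1)) =>
        wHat (partialDeriv hs ht ((I ∘ τ) (Fin.last k)) (u.1 (Fin.init (I ∘ τ))))] with y h5 h6 h7
    rw [value, h3, h6, Pi.smul_apply, h7, Finset.sum_apply]
    simp only [h5]
    rfl
  filter_upwards [ae_all_iff.2 h2] with y hy
  rw [show value (innerDeriv hs ht u) y = _ from funext hy, tensorPoly_symmetrize,
    tensorPoly_mul_last (multiplier y)]

theorem tensorPoly_value_innerDerivIter (hn : 0 < n) (i : ℕ) {s t s' t' : ℝ}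
    (hs : s' + (i : ℝ) = s) (ht : t' + (i : ℝ) = t) (u : SymTensor k n (Sobolev n s t)) :
    ∀ᵐ y, tensorPoly (value (innerDerivIter i hs ht u) y) =
      (∑ j, MvPolynomial.C (multiplier y j) * MvPolynomial.X j) ^ i * tensorPoly (value u y) := by
  induction i generalizing s' t' with
  | zero =>
    -- Identifying the orders turns the transports in the base case of `innerDerivIter` into
    -- identities.
    obtain rfl : s' = s := by simpa using hs
    obtain rfl : t' = t := by simpa using ht
    refine ae_of_all _ fun y => ?_
    rw [pow_zero, one_mul]
    rfl
  | succ i ih =>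
    have hs' : s' + 1 + (i : ℝ) = s := by rw [← hs]; push_cast; ring
    have ht' : t' + 1 + (i : ℝ) = t := by rw [← ht]; push_cast; ring
    filter_upwards [ih hs' ht', tensorPoly_value_innerDeriv hn (s' := s') (t' := t') rfl rfl
      (innerDerivIter i hs' ht' u)] with y h1 h2
    rw [pow_succ', mul_assoc, ← h1, ← h2]
    rfl

theorem tensorPoly_value_cast (h : k = m) (u : SymTensor k n (Sobolev n s t)) (y : E n) :
    tensorPoly (value (SymTensor.cast h u) y) = tensorPoly (value u y) := by
  subst h; rfl

theorem tensorPoly_value_potential (hn : 0 < n) (i : Fin (m + 1))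
    (v : SymTensor (m - i) n (Sobolev n (s + (i : ℕ)) (t + (i : ℕ)))) :
    ∀ᵐ y, tensorPoly (value (potential i v) y) =
      (∑ j, MvPolynomial.C (multiplier y j) * MvPolynomial.X j) ^ (i : ℕ) *
        tensorPoly (value v y) := by
  filter_upwards [tensorPoly_value_innerDerivIter hn i rfl rfl v] with y hy
  rw [← hy, potential, tensorPoly_value_cast]

/-- On the Fourier side the divergence is contraction with the symbol `i y / |y|`, and no
information is lost because `wHat` is injective. -/
theorem isDivergenceFree_succ_iff (hn : 0 < n) (u : SymTensor (k + 1) n (Sobolev n s t)) :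
    IsDivergenceFree u ↔ ∀ᵐ y, ∀ I : Fin k → Fin n,
      ∑ j, multiplier y j * value u y (Fin.snoc (α := fun _ => Fin n) I j) = 0 := by
  have h1 : ∀ I : Fin k → Fin n, ∀ᵐ y,
      wHat (divergence (sub_add_cancel s 1) (sub_add_cancel t 1) u I) y =
        ∑ j, multiplier y j * value u y (Fin.snoc (α := fun _ => Fin n) I j) := fun I => by
    rw [divergence, map_sum]
    have h2 : ∀ᵐ y, ∀ j, wHat (partialDeriv (sub_add_cancel s 1) (sub_add_cancel t 1) j
        (u.1 (Fin.snoc (α := fun _ => Fin n) I j))) y =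
        multiplier y j * value u y (Fin.snoc (α := fun _ => Fin n) I j) :=
      ae_all_iff.2 fun j => by rw [wHat_partialDeriv hn]; exact multiplierL2_coe j _
    filter_upwards [h2, Lp.coeFn_finsetSum Finset.univ fun j => wHat (partialDeriv
      (sub_add_cancel s 1) (sub_add_cancel t 1) j (u.1 (Fin.snoc (α := fun _ => Fin n) I j)))]
      with y h3 h4
    rw [h4, Finset.sum_apply]
    exact Finset.sum_congr rfl fun j _ => h3 j
  change divergence (sub_add_cancel s 1) (sub_add_cancel t 1) u = 0 ↔ _
  constructor
  · intro h
    filter_upwards [ae_all_iff.2 h1, Lp.coeFn_zero ℂ 2 (volume : Measure (E n))] with y h2 h3 I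
    rw [← h2 I, h, Pi.zero_apply, map_zero, h3]; rfl
  · intro h
    refine funext fun I => wHat_injective (Lp.ext ?_)
    filter_upwards [h, h1 I, Lp.coeFn_zero ℂ 2 (volume : Measure (E n))] with y h2 h3 h4
    rw [h3, h2 I, Pi.zero_apply, map_zero, h4]; rfl

end Values

end TensorRadon

namespace TensorRadon

/-! ### Decomposition of tensor fields -/

section Decomposition

variable {d m k : ℕ} {s t : ℝ}

/-- The direction `y / |y|` of a point (a fixed direction at the origin). -/
def direction (y : E (d + 1)) : Metric.sphere (0 : E (d + 1)) 1 :=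
  ⟨if y = 0 then EuclideanSpace.single 0 1 else ‖y‖⁻¹ • y, by
    split_ifs with h
    · simp
    · simp [norm_smul, norm_ne_zero_iff.2 h]⟩

theorem coe_direction {y : E (d + 1)} (hy : y ≠ 0) : (direction y : E (d + 1)) = ‖y‖⁻¹ • y :=
  if_neg hy

theorem measurable_direction : Measurable (direction : E (d + 1) → _) :=
  Measurable.subtype_mk (Measurable.ite (measurableSet_singleton 0) measurable_const (by fun_prop))

theorem multiplier_eq_direction (F : Frame d) {y : E (d + 1)} (hy : y ≠ 0) (j : Fin (d + 1)) :
    multiplier y j = Complex.I * (F.basis (direction y) (Fin.last d) j : ℂ) := by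
  rw [F.basis_last, coe_direction hy, multiplier, PiLp.smul_apply, smul_eq_mul, div_eq_inv_mul]

/-- The frame at the antipodal direction also has its last vector parallel to `y`, with the opposite
sign. This is why the pointwise results below allow an arbitrary scalar `c` (nonzero where needed),
to be taken as `i` or `-i`. -/
theorem multiplier_eq_neg_direction (F : Frame d) {y : E (d + 1)} (hy : y ≠ 0) (j : Fin (d + 1)) :
    multiplier y j = -Complex.I * (F.basis (-direction y) (Fin.last d) j : ℂ) := by
  rw [F.basis_last, coe_neg_sphere, coe_direction hy, multiplier, PiLp.neg_apply, PiLp.smul_apply,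
    smul_eq_mul, div_eq_inv_mul]
  push_cast
  ring

theorem rotPoly_eq_iff {n : ℕ} (b : OrthonormalBasis (Fin n) ℝ (E n)) {T S : (Fin m → Fin n) → ℂ}
    (hT : ∀ (τ : Equiv.Perm (Fin m)) I, T (I ∘ τ) = T I)
    (hS : ∀ (τ : Equiv.Perm (Fin m)) I, S (I ∘ τ) = S I) : rotPoly b T = rotPoly b S ↔ T = S := by
  refine ⟨fun h => ?_, fun h => h ▸ rfl⟩
  refine sub_eq_zero.1 (rotPoly_injective b (fun τ I => by simp [hT, hS]) ?_)
  have h1 := rotPoly_add b (T - S) S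
  rw [sub_add_cancel, h, right_eq_add] at h1
  exact h1

theorem rotPoly_zero {n : ℕ} (b : OrthonormalBasis (Fin n) ℝ (E n)) :
    rotPoly b (0 : (Fin m → Fin n) → ℂ) = 0 := by
  simp [rotPoly, tensorPoly]

theorem rotPoly_sum {n : ℕ} {ι : Type*} (b : OrthonormalBasis (Fin n) ℝ (E n)) (A : Finset ι)
    (T : ι → (Fin m → Fin n) → ℂ) : rotPoly b (∑ i ∈ A, T i) = ∑ i ∈ A, rotPoly b (T i) := by
  classical
  induction A using Finset.induction_on with
  | empty => simp [rotPoly_zero]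
  | insert a A ha ih => rw [Finset.sum_insert ha, rotPoly_add, ih, Finset.sum_insert ha]

/-- The quantifiers over `b` and `c` stand inside the almost-everywhere statement: one null set
serves the frames at `y/|y|` and `-y/|y|` alike, and these depend on `y`. -/
theorem rotPoly_value_sum_potential
    (v : ∀ i : Fin (m + 1), SymTensor (m - i) (d + 1) (Sobolev (d + 1) (s + (i : ℕ)) (t + (i : ℕ)))) :
    ∀ᵐ y, ∀ (b : OrthonormalBasis (Fin (d + 1)) ℝ (E (d + 1))) (c : ℂ),
      (∀ j, multiplier y j = c * (b (Fin.last d) j : ℂ)) →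
      rotPoly b (value (∑ i, potential i (v i)) y) =
        ∑ i : Fin (m + 1), (MvPolynomial.C c * MvPolynomial.X (Fin.last d)) ^ (i : ℕ) *
          rotPoly b (value (v i) y) := by
  filter_upwards [value_sum Finset.univ fun i => potential i (v i),
    ae_all_iff.2 fun i => tensorPoly_value_potential d.succ_pos i (v i)] with y h1 h2 b c hc
  rw [h1, rotPoly_sum]
  refine Finset.sum_congr rfl fun i _ => ?_
  rw [rotPoly, h2, map_mul, map_pow]
  simp only [hc]
  rw [bind_linear, rotPoly]

/-- A divergence-free field has a polynomial free of the variable along the frequency. In order zero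
no condition is needed, since only the constant coefficient can be nonzero. -/
theorem coeff_rotPoly_value_of_isDivergenceFree (u : SymTensor k (d + 1) (Sobolev (d + 1) s t))
    (hu : 0 < k → IsDivergenceFree u) :
    ∀ᵐ y, ∀ (b : OrthonormalBasis (Fin (d + 1)) ℝ (E (d + 1))) (c : ℂ), c ≠ 0 →
      (∀ j, multiplier y j = c * (b (Fin.last d) j : ℂ)) →
      ∀ e : Fin (d + 1) →₀ ℕ, e (Fin.last d) ≠ 0 → (rotPoly b (value u y)).coeff e = 0 := by
  cases k with
  | zero =>
    refine ae_of_all _ fun y b c _ _ e he => ?_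
    rw [rotPoly_eq, coeff_tensorPoly_of_degree_ne]
    have := Finsupp.le_degree (Fin.last d) e
    omega
  | succ k =>
    filter_upwards [(isDivergenceFree_succ_iff d.succ_pos u).1 (hu k.succ_pos)]
      with y hy b c hc hb e he
    refine coeff_rotPoly_of_contraction_eq_zero (value_comp_perm u y) (fun I => ?_) he
    have h := hy I
    simp only [hb, mul_assoc] at h
    rw [← Finset.mul_sum] at h
    exact (mul_eq_zero.1 h).resolve_left hc

/-- The transforms of degree `r` in the direction of the frequency see only the potential of
degree `r`. -/
theorem forall_pairing_value_sum_potential_iff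
    (v : ∀ i : Fin (m + 1), SymTensor (m - i) (d + 1) (Sobolev (d + 1) (s + (i : ℕ)) (t + (i : ℕ))))
    (hv : ∀ i : Fin (m + 1), (i : ℕ) < m → IsDivergenceFree (v i)) (r : Fin (m + 1)) :
    ∀ᵐ y, ∀ (b : OrthonormalBasis (Fin (d + 1)) ℝ (E (d + 1))) (c : ℂ), c ≠ 0 →
      (∀ j, multiplier y j = c * (b (Fin.last d) j : ℂ)) →
      ((∀ (ℓ : Fin (d + 1) → ℕ) (hℓ : ∑ j, ℓ j = m), ℓ (Fin.last d) = r →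
        pairing b ℓ hℓ (value (∑ i, potential i (v i)) y) = 0) ↔ value (v r) y = 0) := by
  filter_upwards [rotPoly_value_sum_potential v, ae_all_iff.2 fun i : Fin (m + 1) =>
    coeff_rotPoly_value_of_isDivergenceFree (v i) fun hi => hv i (by omega)]
    with y h1 h2 b c hc hb
  rw [forall_pairing_eq_zero_iff (value_comp_perm _ y), h1 b c hb]
  have h3 : ∀ e : Fin (d + 1) →₀ ℕ, e (Fin.last d) = r → _ := fun e he =>
    coeff_sum_pow_mul (c := c) (fun i => rotPoly b (value (v i) y)) (fun i => h2 i b c hc hb) r he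
  constructor
  · intro h
    refine rotPoly_injective b (value_comp_perm (v r) y) (MvPolynomial.ext _ _ fun e => ?_)
    rw [MvPolynomial.coeff_zero]
    by_cases he : e (Fin.last d) = 0
    -- A monomial `e` of the polynomial of `v r` reappears in `f` with exponent `r` in the last
    -- variable, multiplied by `c ^ r ≠ 0`.
    · have h4 := h (e + Finsupp.single (Fin.last d) (r : ℕ)) (by simp [he])
      rw [h3 _ (by simp [he]), add_tsub_cancel_right] at h4
      exact (mul_eq_zero.1 h4).resolve_left (pow_ne_zero _ hc)
    · exact h2 r b c hc hb e he
  · intro h e he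
    rw [h3 e he, h, rotPoly_zero]
    simp

theorem potential_zero (i : Fin (m + 1)) :
    potential i (0 : SymTensor (m - i) (d + 1) (Sobolev (d + 1) (s + (i : ℕ)) (t + (i : ℕ)))) = 0 := by
  refine eq_of_value_ae_eq ?_
  filter_upwards [tensorPoly_value_potential d.succ_pos (s := s) (t := t) i 0,
    value_zero (m := m - i) (n := d + 1) (s := s + (i : ℕ)) (t := t + (i : ℕ)),
    value_zero (m := m) (n := d + 1) (s := s) (t := t)] with y h1 h2 h3
  rw [h3]
  refine rotPoly_injective (EuclideanSpace.basisFun (Fin (d + 1)) ℝ) (value_comp_perm _ y) ?_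
  rw [rotPoly, h1, h2]
  simp [tensorPoly]

/-- Replacing the component `r` by zero makes the sum without that term an instance of the full sum,
so results on full sums apply to it. -/
theorem sum_potential_update (r : Fin (m + 1))
    (v : ∀ i : Fin (m + 1), SymTensor (m - i) (d + 1) (Sobolev (d + 1) (s + (i : ℕ)) (t + (i : ℕ)))) :
    ∑ i, potential i (Function.update v r 0 i) = ∑ i ∈ Finset.univ.erase r, potential i (v i) := by
  rw [← Finset.add_sum_erase _ _ (Finset.mem_univ r), Function.update_self, potential_zero, zero_add]
  refine Finset.sum_congr rfl fun i hi => ?_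
  rw [Function.update_of_ne (Finset.ne_of_mem_erase hi)]

theorem IsDivergenceFree.zero : IsDivergenceFree (0 : SymTensor k (d + 1) (Sobolev (d + 1) s t)) := by
  cases k with
  | zero => trivial
  | succ k =>
    rw [isDivergenceFree_succ_iff d.succ_pos]
    filter_upwards [value_zero (m := k + 1) (n := d + 1) (s := s) (t := t)] with y hy I
    simp [hy]

/-- If all components along the direction of the frequency vanish, then so does the contraction with
the symbol, which is `i` times that direction. -/
theorem isDivergenceFree_of_value_eq_unrotate (F : Frame d)
    (u : SymTensor k (d + 1) (Sobolev (d + 1) s t)) (S : E (d + 1) → (Fin k → Fin (d + 1)) → ℂ)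
    (hu : ∀ᵐ y, value u y = unrotate (F.basis (direction y)) (S y))
    (hS : ∀ y J i, J i = Fin.last d → S y J = 0) : IsDivergenceFree u := by
  cases k with
  | zero => trivial
  | succ k =>
    rw [isDivergenceFree_succ_iff d.succ_pos]
    filter_upwards [hu, ae_ne_zero d.succ_pos] with y hy h0 I
    have h1 := contraction_unrotate_eq_zero (b := F.basis (direction y)) (S := S y)
      (fun J hJ => hS y J _ hJ) I
    simp only [multiplier_eq_direction F h0, mul_assoc, hy]
    rw [← Finset.mul_sum, h1, mul_zero]

theorem partAlong_eq_zero (b : OrthonormalBasis (Fin (d + 1)) ℝ (E (d + 1))) (c : ℂ)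
    (T : (Fin m → Fin (d + 1)) → ℂ) (k r : ℕ) {J : Fin k → Fin (d + 1)} {i : Fin k}
    (hi : J i = Fin.last d) : partAlong b c T k r J = 0 := by
  refine if_neg ?_
  rw [indexType_apply]
  have : Nonempty {i // J i = Fin.last d} := ⟨⟨i, hi⟩⟩
  exact Fintype.card_ne_zero

theorem measurable_frame (F : Frame d) (j i : Fin (d + 1)) :
    Measurable fun ω => (F.basis ω j i : ℂ) := by
  have := F.measurable_basis j
  fun_prop

theorem norm_basis_apply_le {n : ℕ} (b : OrthonormalBasis (Fin n) ℝ (E n)) (j i : Fin n) :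
    ‖b j i‖ ≤ 1 :=
  (PiLp.norm_apply_le (b j) i).trans (b.orthonormal.1 j).le

theorem memLp_mul_prod_frame (F : Frame d) (J I : Fin k → Fin (d + 1)) {g : E (d + 1) → ℂ}
    (hg : MemLp g 2 volume) :
    MemLp (fun y => g y * ∏ l, (F.basis (direction y) (J l) (I l) : ℂ)) 2 volume := by
  simp_rw [mul_comm (g _)]
  refine memLp_bdd_mul ?_ (C := 1) (fun y => ?_) hg
  · exact Finset.measurable_prod _ fun l _ => (measurable_frame F _ _).comp measurable_direction
  · rw [norm_prod]
    refine Finset.prod_le_one (fun _ _ => norm_nonneg _) fun l _ => ?_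
    rw [Complex.norm_real]
    exact norm_basis_apply_le _ _ _

/-- The decomposition of a tensor field into potentials of divergence-free fields. -/
theorem exists_eq_sum_potential (F : Frame d) (f : SymTensor m (d + 1) (Sobolev (d + 1) s t)) :
    ∃ v : ∀ i : Fin (m + 1),
        SymTensor (m - i) (d + 1) (Sobolev (d + 1) (s + (i : ℕ)) (t + (i : ℕ))),
      (∀ i : Fin (m + 1), (i : ℕ) < m → IsDivergenceFree (v i)) ∧ f = ∑ i, potential i (v i) := by
  let S : Fin (m + 1) → (k : ℕ) → E (d + 1) → (Fin k → Fin (d + 1)) → ℂ := fun i k y =>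
    partAlong (F.basis (direction y)) Complex.I (value f y) k i
  -- Square integrability survives passage to and from the frame, because the coordinates of the
  -- frame vectors are measurable in `y` and bounded by one.
  have hrot : ∀ J, MemLp (fun y => rotate (F.basis (direction y)) (value f y) J) 2 volume :=
    fun J => memLp_finsetSum _ fun I _ => memLp_mul_prod_frame F J I (Lp.memLp (wHat (f.1 I)))
  have hcoeff : ∀ e, MemLp (fun y =>
      (tensorPoly (rotate (F.basis (direction y)) (value f y))).coeff e) 2 volume := fun e => by
    simp only [coeff_tensorPoly]
    refine memLp_finsetSum _ fun J _ => ?_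
    split_ifs
    · exact hrot J
    · exact MemLp.zero
  have hS : ∀ i k J, MemLp (fun y => S i k y J) 2 volume := fun i k J => by
    simp only [S, partAlong]
    split_ifs
    · exact (hcoeff _).const_mul _
    · exact MemLp.zero
  have hW : ∀ i k I, MemLp (fun y => unrotate (F.basis (direction y)) (S i k y) I) 2 volume :=
    fun i k I => memLp_finsetSum _ fun J _ => memLp_mul_prod_frame F J I (hS i k J)
  -- The gain of `i` orders is automatic: the symbol of `d` is homogeneous of degree zero between
  -- the weighted transforms, and the same `L²` values are read as a field in `H^(s+i)_(t+i)`.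
  have hex : ∀ i : Fin (m + 1),
      ∃ u : SymTensor (m - i) (d + 1) (Sobolev (d + 1) (s + (i : ℕ)) (t + (i : ℕ))),
        ∀ᵐ y, value u y = unrotate (F.basis (direction y)) (S i (m - i) y) := fun i =>
    exists_value_ae_eq d.succ_pos (hW i (m - i)) fun y =>
      unrotate_comp_perm _ (partAlong_comp_perm _ _ _ _ _)
  choose v hv using hex
  refine ⟨v, fun i _ => isDivergenceFree_of_value_eq_unrotate F (v i) _ (hv i)
    fun y J l hl => partAlong_eq_zero _ _ _ _ _ hl, eq_of_value_ae_eq ?_⟩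
  filter_upwards [rotPoly_value_sum_potential v, ae_all_iff.2 hv, ae_ne_zero d.succ_pos]
    with y h1 h2 h3
  rw [← rotPoly_eq_iff (F.basis (direction y)) (value_comp_perm _ y) (value_comp_perm _ y),
    h1 _ _ (multiplier_eq_direction F h3)]
  simp only [h2]
  exact (sum_partAlong _ Complex.I_ne_zero _).symm

end Decomposition

end TensorRadon

namespace TensorRadon

/-! ### The Fourier slice theorem -/

section Slice

variable {d m : ℕ}

/-- The map is the inverse of the orthogonal decomposition along the line through `ω`, with the line
parametrized isometrically by the unit vector. -/
theorem measurePreserving_slice (ω : Metric.sphere (0 : E (d + 1)) 1) :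
    MeasurePreserving (fun q : ℝ × (Submodule.span ℝ {(ω : E (d + 1))})ᗮ =>
      q.1 • (ω : E (d + 1)) + (q.2 : E (d + 1))) := by
  let K := Submodule.span ℝ {(ω : E (d + 1))}
  have h1 : MeasurePreserving (Prod.map
      (LinearIsometryEquiv.toSpanUnitSingleton (𝕜 := ℝ) (ω : E (d + 1)) (norm_eq_of_mem_sphere ω))
      (id : Kᗮ → Kᗮ)) :=
    (LinearIsometryEquiv.measurePreserving _).prod (MeasurePreserving.id _)
  have h2 := (K.orthogonalDecomposition.symm.measurePreserving.comp
    (WithLp.volume_preserving_toLp K Kᗮ)).comp h1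
  convert! h2 using 1

/-- Fubini in the coordinates `x = pω + y`: the phase `⟨x, σω⟩ = pσ` is constant on each hyperplane
and can be taken into the inner integral. -/
theorem integral_slice (ω : Metric.sphere (0 : E (d + 1)) 1) (σ : ℝ) {h : E (d + 1) → ℂ}
    (hi : Integrable h) :
    ∫ p : ℝ, Complex.exp (-Complex.I * (p * σ : ℝ)) *
      ∫ y : (Submodule.span ℝ {(ω : E (d + 1))})ᗮ, h (p • (ω : E (d + 1)) + (y : E (d + 1))) =
    ∫ x, Complex.exp (-Complex.I * ((inner ℝ x (σ • (ω : E (d + 1))) : ℝ) : ℂ)) * h x := by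
  let k : E (d + 1) → ℂ := fun x =>
    Complex.exp (-Complex.I * ((inner ℝ x (σ • (ω : E (d + 1))) : ℝ) : ℂ)) * h x
  have hk : Integrable k := by
    refine hi.bdd_mul (c := 1) (Continuous.aestronglyMeasurable (by fun_prop))
      (ae_of_all _ fun x => ?_)
    rw [neg_mul, mul_comm, ← neg_mul, ← Complex.ofReal_neg, Complex.norm_exp_ofReal_mul_I]
  have hmp := measurePreserving_slice ω
  have h1 : ∫ x, k x = ∫ q : ℝ × (Submodule.span ℝ {(ω : E (d + 1))})ᗮ,
      k (q.1 • (ω : E (d + 1)) + (q.2 : E (d + 1))) := by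
    rw [← integral_map hmp.aemeasurable (hmp.map_eq.symm ▸ hk.1), hmp.map_eq]
  have h2 := (hmp.integrable_comp hk.1).2 hk
  change _ = ∫ x, k x
  rw [h1, Measure.volume_eq_prod]
  refine Eq.trans ?_ (integral_prod _ h2).symm
  refine integral_congr_ae (ae_of_all _ fun p => ?_)
  change _ * _ = _
  rw [← integral_const_mul]
  refine integral_congr_ae (ae_of_all _ fun y => ?_)
  have h3 : inner ℝ (p • (ω : E (d + 1)) + (y : E (d + 1))) (σ • (ω : E (d + 1))) = p * σ := by
    have h4 : inner ℝ (y : E (d + 1)) (ω : E (d + 1)) = (0 : ℝ) :=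
      Submodule.inner_left_of_mem_orthogonal (Submodule.mem_span_singleton_self _) y.2
    rw [inner_add_left, inner_smul_left, inner_smul_right, inner_smul_right, h4,
      real_inner_self_eq_norm_sq, norm_eq_of_mem_sphere ω]
    simp
  simp only [k, Function.comp_apply, h3]

/-- The Fourier slice theorem for the generalized Radon transform. -/
theorem hatP_schwartzRadon (F : Frame d) (ℓ : Fin (d + 1) → ℕ) (hℓ : ∑ j, ℓ j = m)
    (f : SymTensor m (d + 1) 𝓢(E (d + 1), ℂ)) (ω : Metric.sphere (0 : E (d + 1)) 1) (σ : ℝ) :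
    hatP (schwartzRadon F ℓ hℓ f ω) σ = (((2 * π) ^ ((d : ℝ) / 2) : ℝ) : ℂ) *
      pairing (F.basis ω) ℓ hℓ fun I => fourierHat (f.1 I) (σ • (ω : E (d + 1))) := by
  have hint : ∀ I, Integrable fun x => f.1 I x * (symProd (repeated (F.basis ω) ℓ hℓ) I : ℂ) :=
    fun I => (f.1 I).integrable.mul_const _
  have hsum := integrable_finsetSum Finset.univ fun I _ => hint I
  rw [hatP]
  have h1 := integral_slice ω σ hsum
  simp only [schwartzRadon]
  rw [h1]
  simp only [Finset.mul_sum, ← mul_assoc, pairing]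
  rw [integral_finsetSum _ fun I _ => ?_]
  · rw [Finset.mul_sum]
    refine Finset.sum_congr rfl fun I _ => ?_
    rw [integral_mul_const, fourierHat, ← mul_assoc, ← mul_assoc, ← Complex.ofReal_mul,
      ← Real.rpow_add (by positivity)]
    -- The powers of `2π` match because `-1/2 = d/2 - (d+1)/2`.
    congr 4
    push_cast
    ring
  · refine Integrable.mul_const ?_ _
    refine (f.1 I).integrable.bdd_mul (c := 1) (Continuous.aestronglyMeasurable (by fun_prop))
      (ae_of_all _ fun x => ?_)
    rw [neg_mul, mul_comm, ← neg_mul, ← Complex.ofReal_neg, Complex.norm_exp_ofReal_mul_I]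

end Slice

/-! ### Polar coordinates -/

section Polar

variable {d : ℕ}

/-- The integrand carries the direction as a separate argument, since it will involve the frame at
`ω` in addition to the point `σω`. -/
theorem lintegral_polar {K : Metric.sphere (0 : E (d + 1)) 1 → E (d + 1) → ℝ≥0∞}
    (hK : Measurable (Function.uncurry K)) :
    ∫⁻ ω, (∫⁻ σ in Set.Ioi (0 : ℝ), ENNReal.ofReal (|σ| ^ d) * K ω (σ • (ω : E (d + 1))))
      ∂(volume : Measure (E (d + 1))).toSphere = ∫⁻ y, K (direction y) y := by
  have hmp := (volume : Measure (E (d + 1))).measurePreserving_homeomorphUnitSphereProd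
  have hdim : Module.finrank ℝ (E (d + 1)) - 1 = d := by simp
  rw [hdim] at hmp
  have hm : Measurable fun q : Metric.sphere (0 : E (d + 1)) 1 × Set.Ioi (0 : ℝ) =>
      K q.1 ((q.2 : ℝ) • (q.1 : E (d + 1))) :=
    hK.comp (Measurable.prodMk measurable_fst (by fun_prop))
  have h1 : ∫⁻ y, K (direction y) y =
      ∫⁻ y : ({0}ᶜ : Set (E (d + 1))), K (direction y) y ∂(Measure.comap Subtype.val volume) := by
    rw [lintegral_subtype_comap (measurableSet_singleton _).compl fun y => K (direction y) y,
      restrict_compl_singleton]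
  rw [h1]
  have h2 : ∀ y : ({0}ᶜ : Set (E (d + 1))), K (direction y) y =
      (fun q : Metric.sphere (0 : E (d + 1)) 1 × Set.Ioi (0 : ℝ) =>
        K q.1 ((q.2 : ℝ) • (q.1 : E (d + 1)))) (homeomorphUnitSphereProd _ y) := fun y => by
    have hy : (y : E (d + 1)) ≠ 0 := y.2
    have h3 : (homeomorphUnitSphereProd _ y).1 = direction (y : E (d + 1)) := by
      ext1
      rw [coe_direction hy, homeomorphUnitSphereProd_apply_fst_coe]
    simp only [h3, homeomorphUnitSphereProd_apply_snd_coe, coe_direction hy]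
    rw [smul_smul, mul_inv_cancel₀ (norm_ne_zero_iff.2 hy), one_smul]
  simp_rw [h2]
  rw [hmp.lintegral_comp hm, lintegral_prod _ hm.aemeasurable]
  refine lintegral_congr fun ω => ?_
  have h4 : Measurable fun σ : Set.Ioi (0 : ℝ) => K ω ((σ : ℝ) • (ω : E (d + 1))) :=
    hm.comp measurable_prodMk_left
  rw [Measure.volumeIoiPow, lintegral_withDensity_eq_lintegral_mul _ (by fun_prop) h4,
    ← lintegral_subtype_comap measurableSet_Ioi]
  refine lintegral_congr fun σ => ?_
  have hσ : (0 : ℝ) < σ := σ.2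
  simp [abs_of_pos hσ]

theorem direction_neg {y : E (d + 1)} (hy : y ≠ 0) : direction (-y) = -direction y := by
  ext1
  rw [coe_direction (neg_ne_zero.2 hy), coe_neg_sphere, coe_direction hy, norm_neg, smul_neg]

/-- The two half-lines each sweep out the whole space: `σ > 0` meets `y` with `ω = y/|y|`, and `σ <
0` meets it with `ω = -y/|y|`. The integrals stay separate because `K` is not assumed to be even in
`ω`. -/
theorem lintegral_lines {K : Metric.sphere (0 : E (d + 1)) 1 → E (d + 1) → ℝ≥0∞}
    (hK : Measurable (Function.uncurry K)) :
    ∫⁻ ω, (∫⁻ σ : ℝ, ENNReal.ofReal (|σ| ^ d) * K ω (σ • (ω : E (d + 1))))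
      ∂(volume : Measure (E (d + 1))).toSphere =
      (∫⁻ y, K (direction y) y) + ∫⁻ y, K (-direction y) y := by
  have hK' : Measurable (Function.uncurry fun ω y => K ω (-y)) :=
    hK.comp (measurable_fst.prodMk measurable_snd.neg)
  have hneg : ∫⁻ y, K (-direction y) y = ∫⁻ y, K (direction y) (-y) := by
    rw [← (Measure.measurePreserving_neg (volume : Measure (E (d + 1)))).lintegral_comp
      (f := fun y => K (direction y) (-y)) (hK'.comp (measurable_direction.prodMk measurable_id))]
    refine lintegral_congr_ae ?_
    filter_upwards [ae_ne_zero d.succ_pos] with y hy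
    rw [direction_neg hy, neg_neg]
  rw [hneg, ← lintegral_polar hK, ← lintegral_polar hK', ← lintegral_add_left]
  · refine lintegral_congr fun ω => ?_
    rw [← lintegral_add_compl _ (measurableSet_Ioi (a := (0 : ℝ))), Set.compl_Ioi,
      setLIntegral_congr Iio_ae_eq_Iic.symm]
    congr 1
    rw [← (Measure.measurePreserving_neg (volume : Measure ℝ)).setLIntegral_comp_preimage_emb
      (MeasurableEquiv.neg ℝ).measurableEmbedding _ (Set.Iio 0)]
    simp
  · refine Measurable.lintegral_prod_right'
      (f := fun q : Metric.sphere (0 : E (d + 1)) 1 × ℝ =>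
        ENNReal.ofReal (|q.2| ^ d) * K q.1 (q.2 • (q.1 : E (d + 1)))) ?_
    exact Measurable.mul (by fun_prop) (hK.comp (Measurable.prodMk measurable_fst (by fun_prop)))

end Polar

/-! ### The Radon transform on the Sobolev spaces -/

section Radon

variable {d m : ℕ} {s t : ℝ}

/-- The Fourier transform of the Radon transform, in terms of the weighted Fourier transform of the
tensor field. -/
def radonHat (F : Frame d) (ℓ : Fin (d + 1) → ℕ) (hℓ : ∑ j, ℓ j = m) (s t : ℝ)
    (H : E (d + 1) → (Fin m → Fin (d + 1)) → ℂ) (ω : Metric.sphere (0 : E (d + 1)) 1) (σ : ℝ) : ℂ :=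
  (((2 * π) ^ ((d : ℝ) / 2) * (rootWeight s t (σ • (ω : E (d + 1))))⁻¹ : ℝ) : ℂ) *
    pairing (F.basis ω) ℓ hℓ (H (σ • (ω : E (d + 1))))

theorem pairing_sub {n : ℕ} (b : Fin n → E n) (ℓ : Fin n → ℕ) (hℓ : ∑ j, ℓ j = m)
    (T S : (Fin m → Fin n) → ℂ) : pairing b ℓ hℓ (T - S) = pairing b ℓ hℓ T - pairing b ℓ hℓ S := by
  simp [pairing, sub_mul, Finset.sum_sub_distrib]

theorem radonHat_sub (F : Frame d) (ℓ : Fin (d + 1) → ℕ) (hℓ : ∑ j, ℓ j = m)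
    (H H' : E (d + 1) → (Fin m → Fin (d + 1)) → ℂ) (ω : Metric.sphere (0 : E (d + 1)) 1) (σ : ℝ) :
    radonHat F ℓ hℓ s t (H - H') ω σ = radonHat F ℓ hℓ s t H ω σ - radonHat F ℓ hℓ s t H' ω σ := by
  simp only [radonHat, Pi.sub_apply, pairing_sub]
  ring

theorem measurable_symProd (F : Frame d) (ℓ : Fin (d + 1) → ℕ) (hℓ : ∑ j, ℓ j = m)
    (I : Fin m → Fin (d + 1)) :
    Measurable fun ω => (symProd (repeated (F.basis ω) ℓ hℓ) I : ℂ) := by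
  refine Complex.measurable_ofReal.comp ?_
  unfold symProd
  refine Measurable.const_mul (Finset.measurable_fun_sum _ fun τ _ =>
    Finset.measurable_fun_prod _ fun k _ => ?_) _
  have := F.measurable_basis (sortedIndex ℓ hℓ (τ k))
  unfold repeated
  unfold sortedIndex at this
  fun_prop

theorem measurable_pairing {X : Type*} [MeasurableSpace X] (F : Frame d) (ℓ : Fin (d + 1) → ℕ)
    (hℓ : ∑ j, ℓ j = m) {ω : X → Metric.sphere (0 : E (d + 1)) 1} (hω : Measurable ω)
    {H : X → (Fin m → Fin (d + 1)) → ℂ} (hH : ∀ I, Measurable fun x => H x I) :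
    Measurable fun x => pairing (F.basis (ω x)) ℓ hℓ (H x) :=
  Finset.measurable_fun_sum _ fun I _ => (hH I).mul ((measurable_symProd F ℓ hℓ I).comp hω)

theorem measurable_radonHat (F : Frame d) (ℓ : Fin (d + 1) → ℕ) (hℓ : ∑ j, ℓ j = m)
    {H : E (d + 1) → (Fin m → Fin (d + 1)) → ℂ} (hH : ∀ I, Measurable fun y => H y I) :
    Measurable (Function.uncurry (radonHat F ℓ hℓ s t H)) := by
  have h1 : Measurable fun q : Metric.sphere (0 : E (d + 1)) 1 × ℝ => q.2 • (q.1 : E (d + 1)) := by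
    fun_prop
  refine Measurable.mul (Complex.measurable_ofReal.comp
    (((measurable_rootWeight s t).comp h1).inv.const_mul _)) ?_
  exact measurable_pairing F ℓ hℓ measurable_fst fun I => (hH I).comp h1

/-- The shift of both orders by `d/2` supplies exactly the Jacobian `|σ|^d` of polar coordinates.
The root weight cancels, and `(2π)^d` from the slice theorem against `1/(2(2π)^d)` leaves `1/2`. -/
theorem sphereNormSq_radonHat (F : Frame d) (ℓ : Fin (d + 1) → ℕ) (hℓ : ∑ j, ℓ j = m)
    {H : E (d + 1) → (Fin m → Fin (d + 1)) → ℂ} (hH : ∀ I, Measurable fun y => H y I) :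
    sphereNormSq (s + (d : ℝ) / 2) (t + (d : ℝ) / 2) (radonHat F ℓ hℓ s t H) =
      ENNReal.ofReal (1 / 2) *
        ((∫⁻ y, ENNReal.ofReal (‖pairing (F.basis (direction y)) ℓ hℓ (H y)‖ ^ 2)) +
          ∫⁻ y, ENNReal.ofReal (‖pairing (F.basis (-direction y)) ℓ hℓ (H y)‖ ^ 2)) := by
  have hm : Measurable (Function.uncurry fun (ω : Metric.sphere (0 : E (d + 1)) 1) y =>
      ENNReal.ofReal (‖pairing (F.basis ω) ℓ hℓ (H y)‖ ^ 2)) :=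
    ENNReal.measurable_ofReal.comp ((measurable_pairing F ℓ hℓ measurable_fst fun I => (hH I).comp measurable_snd).norm.pow_const 2)
  rw [← lintegral_lines hm, sphereNormSq]
  have h1 : ∀ (ω : Metric.sphere (0 : E (d + 1)) 1), ∫⁻ σ : ℝ, ENNReal.ofReal
      (|σ| ^ (2 * (t + (d : ℝ) / 2)) * (1 + |σ| ^ 2) ^ (s + (d : ℝ) / 2 - (t + (d : ℝ) / 2)) *
        ‖radonHat F ℓ hℓ s t H ω σ‖ ^ 2) = ENNReal.ofReal ((2 * π) ^ d) *
      ∫⁻ σ : ℝ, ENNReal.ofReal (|σ| ^ d) *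
        ENNReal.ofReal (‖pairing (F.basis ω) ℓ hℓ (H (σ • (ω : E (d + 1))))‖ ^ 2) := fun ω => by
    rw [← lintegral_const_mul' _ _ ENNReal.ofReal_ne_top]
    refine lintegral_congr_ae ?_
    filter_upwards [Measure.ae_ne (volume : Measure ℝ) 0] with σ hσ
    rw [← ENNReal.ofReal_mul (by positivity), ← ENNReal.ofReal_mul (by positivity)]
    congr 1
    have hσ' : 0 < |σ| := abs_pos.2 hσ
    have hnorm : ‖σ • (ω : E (d + 1))‖ = |σ| := by
      rw [norm_smul, norm_eq_of_mem_sphere ω, mul_one, Real.norm_eq_abs]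
    have hw : rootWeight s t (σ • (ω : E (d + 1))) ^ 2 =
        |σ| ^ (2 * t) * (1 + |σ| ^ 2) ^ (s - t) := by rw [rootWeight_sq, hnorm]
    have hpi : ((2 * π) ^ ((d : ℝ) / 2)) ^ 2 = (2 * π) ^ d := by
      rw [← Real.rpow_mul_natCast (by positivity), ← Real.rpow_natCast]
      congr 1
      push_cast
      ring
    have hreal : ∀ x : ℝ, ‖(x : ℂ)‖ ^ 2 = x ^ 2 := fun x => by
      rw [Complex.norm_real, Real.norm_eq_abs, sq_abs]
    rw [radonHat, norm_mul, mul_pow, hreal, mul_pow, inv_pow, hw, hpi, add_sub_add_right_eq_sub, mul_add, Real.rpow_add hσ',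
      show 2 * ((d : ℝ) / 2) = (d : ℝ) by ring, Real.rpow_natCast]
    field_simp
  simp_rw [h1]
  rw [lintegral_const_mul' _ _ ENNReal.ofReal_ne_top, ← mul_assoc,
    ← ENNReal.ofReal_mul (by positivity)]
  congr 2
  field_simp

theorem sphereNormSq_congr {A B : Metric.sphere (0 : E (d + 1)) 1 → ℝ → ℂ}
    (h : ∀ ω σ, σ ≠ 0 → ‖A ω σ‖ = ‖B ω σ‖) : sphereNormSq s t A = sphereNormSq s t B := by
  rw [sphereNormSq, sphereNormSq]
  congr 1
  refine lintegral_congr fun ω => lintegral_congr_ae ?_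
  filter_upwards [Measure.ae_ne (volume : Measure ℝ) 0] with σ hσ
  rw [h ω σ hσ]

/-- The inequality `(a + b)² ≤ 2(a² + b²)` serves as a triangle inequality: the factor two is
harmless, as it is only used for limits and distances equal to zero. -/
theorem sphereNormSq_add_le {A B : Metric.sphere (0 : E (d + 1)) 1 → ℝ → ℂ}
    (hA : Measurable (Function.uncurry A)) :
    sphereNormSq s t (fun ω σ => A ω σ + B ω σ) ≤
      2 * sphereNormSq s t A + 2 * sphereNormSq s t B := by
  have hmeas : Measurable fun q : Metric.sphere (0 : E (d + 1)) 1 × ℝ =>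
      2 * ENNReal.ofReal (|q.2| ^ (2 * t) * (1 + |q.2| ^ 2) ^ (s - t) * ‖A q.1 q.2‖ ^ 2) := by
    have : Measurable fun q : Metric.sphere (0 : E (d + 1)) 1 × ℝ => A q.1 q.2 := hA
    fun_prop
  have hpt : ∀ ω σ, ENNReal.ofReal
      (|σ| ^ (2 * t) * (1 + |σ| ^ 2) ^ (s - t) * ‖A ω σ + B ω σ‖ ^ 2) ≤
      2 * ENNReal.ofReal (|σ| ^ (2 * t) * (1 + |σ| ^ 2) ^ (s - t) * ‖A ω σ‖ ^ 2) +
        2 * ENNReal.ofReal (|σ| ^ (2 * t) * (1 + |σ| ^ 2) ^ (s - t) * ‖B ω σ‖ ^ 2) := by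
    intro ω σ
    have h2 : (2 : ℝ≥0∞) = ENNReal.ofReal 2 := by simp
    rw [h2, ← ENNReal.ofReal_mul (by norm_num), ← ENNReal.ofReal_mul (by norm_num),
      ← ENNReal.ofReal_add (by positivity) (by positivity)]
    refine ENNReal.ofReal_le_ofReal ?_
    have h3 : ‖A ω σ + B ω σ‖ ^ 2 ≤ 2 * (‖A ω σ‖ ^ 2 + ‖B ω σ‖ ^ 2) :=
      (pow_le_pow_left₀ (norm_nonneg _) (norm_add_le _ _) 2).trans add_sq_le
    have h4 : 0 ≤ |σ| ^ (2 * t) * (1 + |σ| ^ 2) ^ (s - t) := by positivity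
    nlinarith [mul_le_mul_of_nonneg_left h3 h4]
  let X : (Metric.sphere (0 : E (d + 1)) 1 → ℝ → ℂ) → ℝ≥0∞ := fun A =>
    ∫⁻ ω, (∫⁻ σ : ℝ, ENNReal.ofReal (|σ| ^ (2 * t) * (1 + |σ| ^ 2) ^ (s - t) * ‖A ω σ‖ ^ 2))
      ∂(volume : Measure (E (d + 1))).toSphere
  have key : X (fun ω σ => A ω σ + B ω σ) ≤ 2 * X A + 2 * X B := by
    simp only [X]
    rw [← lintegral_const_mul' _ _ (by norm_num), ← lintegral_const_mul' _ _ (by norm_num)]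
    simp_rw [← lintegral_const_mul' (2 : ℝ≥0∞) _ (by norm_num)]
    rw [← lintegral_add_left hmeas.lintegral_prod_right']
    refine lintegral_mono fun ω => ?_
    exact (lintegral_mono (hpt ω)).trans_eq
      (lintegral_add_left (hmeas.comp measurable_prodMk_left) _)
  calc sphereNormSq s t (fun ω σ => A ω σ + B ω σ)
      ≤ ENNReal.ofReal (1 / (2 * (2 * π) ^ d)) * (2 * X A + 2 * X B) :=
        mul_le_mul_right key _
    _ = 2 * (ENNReal.ofReal (1 / (2 * (2 * π) ^ d)) * X A) +
        2 * (ENNReal.ofReal (1 / (2 * (2 * π) ^ d)) * X B) := by ring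

theorem sphereNormSq_sub_le {A B C : Metric.sphere (0 : E (d + 1)) 1 → ℝ → ℂ}
    (hA : Measurable (Function.uncurry A)) (hB : Measurable (Function.uncurry B)) :
    sphereNormSq s t (fun ω σ => A ω σ - C ω σ) ≤
      2 * sphereNormSq s t (fun ω σ => A ω σ - B ω σ) +
        2 * sphereNormSq s t (fun ω σ => B ω σ - C ω σ) := by
  have h := sphereNormSq_add_le (s := s) (t := t) (A := fun ω σ => A ω σ - B ω σ)
    (B := fun ω σ => B ω σ - C ω σ) (hA.sub hB)
  simpa only [sub_add_sub_cancel] using h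

theorem sphereNormSq_sub_comm (A B : Metric.sphere (0 : E (d + 1)) 1 → ℝ → ℂ) :
    sphereNormSq s t (fun ω σ => A ω σ - B ω σ) = sphereNormSq s t (fun ω σ => B ω σ - A ω σ) :=
  sphereNormSq_congr fun _ _ _ => norm_sub_rev _ _

/-- The weighted Fourier transform of a Schwartz tensor field. -/
def schwartzValue (g : SymTensor m (d + 1) (PreSobolev (d + 1) s t)) (y : E (d + 1))
    (I : Fin m → Fin (d + 1)) : ℂ :=
  weightedHat s t (g.1 I).toSchwartz y

/-- A Schwartz tensor field as an element of the completion. -/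
def toCompletion (g : SymTensor m (d + 1) (PreSobolev (d + 1) s t)) :
    SymTensor m (d + 1) (Sobolev (d + 1) s t) :=
  SymTensor.map (UniformSpace.Completion.toComplL (𝕜 := ℂ)
      (E := PreSobolev (d + 1) s t)).toLinearMap g

theorem value_toCompletion (g : SymTensor m (d + 1) (PreSobolev (d + 1) s t)) :
    ∀ᵐ y, value (toCompletion g) y = schwartzValue g y := by
  have : ∀ I, ∀ᵐ y, value (toCompletion g) y I = schwartzValue g y I := fun I => by
    filter_upwards [(g.1 I).toL2_coe] with y hy
    rw [schwartzValue, ← hy, ← wHat_coe]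
    rfl
  filter_upwards [ae_all_iff.2 this] with y hy
  exact funext hy

/-- The slice theorem with the weight inserted and removed again, which is legitimate where the
weight does not vanish. -/
theorem hatP_eq_radonHat (F : Frame d) (ℓ : Fin (d + 1) → ℕ) (hℓ : ∑ j, ℓ j = m)
    (g : SymTensor m (d + 1) (PreSobolev (d + 1) s t)) (ω : Metric.sphere (0 : E (d + 1)) 1) {σ : ℝ}
    (hσ : σ ≠ 0) :
    hatP (schwartzRadon F ℓ hℓ (SymTensor.map PreSobolev.toSchwartz g) ω) σ =
      radonHat F ℓ hℓ s t (schwartzValue g) ω σ := by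
  have hne : σ • (ω : E (d + 1)) ≠ 0 := by
    rw [← norm_ne_zero_iff, norm_smul, norm_eq_of_mem_sphere ω]
    simpa using hσ
  have hw : (rootWeight s t (σ • (ω : E (d + 1))) : ℂ) ≠ 0 := by
    exact_mod_cast (rootWeight_pos hne).ne'
  rw [hatP_schwartzRadon, radonHat, pairing, pairing, Finset.mul_sum, Finset.mul_sum]
  refine Finset.sum_congr rfl fun I _ => ?_
  rw [schwartzValue, weightedHat, Complex.ofReal_mul, Complex.ofReal_inv]
  field_simp
  exact mul_right_comm _ _ _

theorem abs_symProd_le {n : ℕ} {a : Fin m → E n} (ha : ∀ k, ‖a k‖ ≤ 1) (I : Fin m → Fin n) :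
    |symProd a I| ≤ 1 := by
  have hm : (0 : ℝ) < (m ! : ℝ) := by exact_mod_cast Nat.factorial_pos m
  rw [symProd, abs_mul, abs_of_pos (inv_pos.2 hm), inv_mul_le_iff₀ hm, mul_one]
  refine (Finset.abs_sum_le_sum_abs _ _).trans ?_
  have : ∀ τ : Equiv.Perm (Fin m), |∏ k, a (τ k) (I k)| ≤ 1 := fun τ => by
    rw [Finset.abs_prod]
    exact Finset.prod_le_one (fun _ _ => abs_nonneg _)
      fun k _ => (PiLp.norm_apply_le (a (τ k)) (I k)).trans (ha _)
  refine (Finset.sum_le_sum fun τ _ => this τ).trans ?_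
  simp [Fintype.card_perm]

/-- Frame vectors have norm one, so the coefficients of the pairing are at most one, and
Cauchy–Schwarz gives a bound independent of the basis. This uniformity in `ω` yields the continuity
of the transform. -/
theorem norm_pairing_sq_le {n : ℕ} (b : OrthonormalBasis (Fin n) ℝ (E n)) (ℓ : Fin n → ℕ)
    (hℓ : ∑ j, ℓ j = m) (T : (Fin m → Fin n) → ℂ) :
    ‖pairing b ℓ hℓ T‖ ^ 2 ≤ Fintype.card (Fin m → Fin n) * ∑ I, ‖T I‖ ^ 2 := by
  have h1 : ‖pairing b ℓ hℓ T‖ ≤ ∑ I, ‖T I‖ := by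
    refine (norm_sum_le _ _).trans (Finset.sum_le_sum fun I _ => ?_)
    rw [norm_mul, Complex.norm_real]
    exact mul_le_of_le_one_right (norm_nonneg _)
      (abs_symProd_le (fun k => (b.orthonormal.1 _).le) I)
  exact (pow_le_pow_left₀ (norm_nonneg _) h1 2).trans (sq_sum_le_card_mul_sum_sq (s := Finset.univ))

theorem lintegral_norm_value_sq (u : SymTensor m (d + 1) (Sobolev (d + 1) s t))
    (I : Fin m → Fin (d + 1)) :
    ∫⁻ y, ENNReal.ofReal (‖value u y I‖ ^ 2) = ENNReal.ofReal (‖u.1 I‖ ^ 2) := by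
  have h := eLpNorm_nnreal_pow_eq_lintegral (p := 2) (f := fun y => value u y I)
    (μ := volume) (by simp)
  rw [← norm_wHat, ENNReal.ofReal_pow (norm_nonneg _), ofReal_norm, Lp.enorm_def]
  simp only [ENNReal.ofReal_pow (norm_nonneg _), ofReal_norm]
  rw [show eLpNorm (wHat (u.1 I)) 2 volume = eLpNorm (fun y => value u y I) 2 volume from rfl]
  simpa using h.symm

theorem sphereNormSq_radonHat_value_le (F : Frame d) (ℓ : Fin (d + 1) → ℕ) (hℓ : ∑ j, ℓ j = m)
    (u : SymTensor m (d + 1) (Sobolev (d + 1) s t)) :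
    sphereNormSq (s + (d : ℝ) / 2) (t + (d : ℝ) / 2) (radonHat F ℓ hℓ s t (value u)) ≤
      ∑ I, Fintype.card (Fin m → Fin (d + 1)) * ENNReal.ofReal (‖u.1 I‖ ^ 2) := by
  rw [sphereNormSq_radonHat F ℓ hℓ (measurable_value u)]
  have hb : ∀ ω : E (d + 1) → Metric.sphere (0 : E (d + 1)) 1,
      ∫⁻ y, ENNReal.ofReal (‖pairing (F.basis (ω y)) ℓ hℓ (value u y)‖ ^ 2) ≤
        ∑ I, Fintype.card (Fin m → Fin (d + 1)) * ENNReal.ofReal (‖u.1 I‖ ^ 2) := fun ω => by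
    have hm : ∀ I, Measurable fun y => (Fintype.card (Fin m → Fin (d + 1)) : ℝ≥0∞) *
        ENNReal.ofReal (‖value u y I‖ ^ 2) := fun I => by
      have := measurable_value u I
      fun_prop
    simp_rw [← lintegral_norm_value_sq]
    simp_rw [← lintegral_const_mul' (Fintype.card (Fin m → Fin (d + 1)) : ℝ≥0∞) _
      (ENNReal.natCast_ne_top _)]
    rw [← lintegral_finsetSum _ fun I _ => hm I]
    refine lintegral_mono fun y => ?_
    refine (ENNReal.ofReal_le_ofReal (norm_pairing_sq_le (F.basis (ω y)) ℓ hℓ (value u y))).trans ?_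
    rw [Finset.mul_sum, ENNReal.ofReal_sum_of_nonneg fun _ _ => by positivity]
    refine Finset.sum_le_sum fun I _ => ?_
    rw [ENNReal.ofReal_mul (by positivity), ENNReal.ofReal_natCast]
  refine (mul_le_mul_right (α := ℝ≥0∞) (add_le_add (hb _) (hb _)) _).trans ?_
  rw [← two_mul, ← mul_assoc, show (2 : ℝ≥0∞) = ENNReal.ofReal 2 by simp,
    ← ENNReal.ofReal_mul (by norm_num)]
  norm_num

theorem sphereNormSq_radonHat_congr (F : Frame d) (ℓ : Fin (d + 1) → ℕ) (hℓ : ∑ j, ℓ j = m)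
    {H H' : E (d + 1) → (Fin m → Fin (d + 1)) → ℂ} (hH : ∀ I, Measurable fun y => H y I)
    (hH' : ∀ I, Measurable fun y => H' y I) (h : ∀ᵐ y, H y = H' y) :
    sphereNormSq (s + (d : ℝ) / 2) (t + (d : ℝ) / 2) (radonHat F ℓ hℓ s t H) =
      sphereNormSq (s + (d : ℝ) / 2) (t + (d : ℝ) / 2) (radonHat F ℓ hℓ s t H') := by
  rw [sphereNormSq_radonHat F ℓ hℓ hH, sphereNormSq_radonHat F ℓ hℓ hH']
  congr 2 <;>
  · refine lintegral_congr_ae ?_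
    filter_upwards [h] with y hy
    rw [hy]

theorem measurable_schwartzValue (g : SymTensor m (d + 1) (PreSobolev (d + 1) s t))
    (I : Fin m → Fin (d + 1)) : Measurable fun y => schwartzValue g y I :=
  measurable_weightedHat s t _

theorem sphereNormSq_schwartz_sub_le (F : Frame d) (ℓ : Fin (d + 1) → ℕ) (hℓ : ∑ j, ℓ j = m)
    (g : SymTensor m (d + 1) (PreSobolev (d + 1) s t))
    (f : SymTensor m (d + 1) (Sobolev (d + 1) s t)) :
    sphereNormSq (s + (d : ℝ) / 2) (t + (d : ℝ) / 2) (fun ω σ =>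
      radonHat F ℓ hℓ s t (schwartzValue g) ω σ - radonHat F ℓ hℓ s t (value f) ω σ) ≤
      ∑ I, Fintype.card (Fin m → Fin (d + 1)) *
        ENNReal.ofReal (‖(toCompletion g - f).1 I‖ ^ 2) := by
  refine le_trans (le_of_eq ?_) (sphereNormSq_radonHat_value_le F ℓ hℓ (toCompletion g - f))
  simp_rw [← radonHat_sub]
  refine sphereNormSq_radonHat_congr F ℓ hℓ (fun I => ?_) (measurable_value _) ?_
  · exact (measurable_schwartzValue g I).sub (measurable_value f I)
  · filter_upwards [value_toCompletion g, value_sub (toCompletion g) f] with y h1 h2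
    rw [h2, h1, Pi.sub_apply]

theorem tendsto_sphereNormSq_schwartz_sub (F : Frame d) (ℓ : Fin (d + 1) → ℕ)
    (hℓ : ∑ j, ℓ j = m) (f : SymTensor m (d + 1) (Sobolev (d + 1) s t)) :
    Tendsto (fun g : SymTensor m (d + 1) (PreSobolev (d + 1) s t) =>
      sphereNormSq (s + (d : ℝ) / 2) (t + (d : ℝ) / 2) (fun ω σ =>
        radonHat F ℓ hℓ s t (schwartzValue g) ω σ - radonHat F ℓ hℓ s t (value f) ω σ))
      (comap toCompletion (𝓝 f)) (𝓝 0) := by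
  refine tendsto_of_tendsto_of_tendsto_of_le_of_le tendsto_const_nhds ?_ (fun _ => bot_le)
    fun g => sphereNormSq_schwartz_sub_le F ℓ hℓ g f
  let B : SymTensor m (d + 1) (Sobolev (d + 1) s t) → ℝ≥0∞ := fun u =>
    ∑ I, Fintype.card (Fin m → Fin (d + 1)) * ENNReal.ofReal (‖(u - f).1 I‖ ^ 2)
  have hB : Continuous B := by
    refine continuous_finsetSum _ fun I _ => ?_
    refine (ENNReal.continuous_const_mul (ENNReal.natCast_ne_top _)).comp
      (ENNReal.continuous_ofReal.comp ?_)
    have : Continuous fun u : SymTensor m (d + 1) (Sobolev (d + 1) s t) => u.1 I - f.1 I :=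
      ((continuous_apply I).comp continuous_subtype_val).sub continuous_const
    exact this.norm.pow 2
  have h0 : B f = 0 := by simp [B]
  have h1 := hB.tendsto f
  rw [h0] at h1
  exact h1.comp tendsto_comap

/-- Density holds componentwise for arbitrary arrays. Symmetrization is a continuous surjection onto
symmetric tensors and commutes with the embedding, so it carries density over. -/
theorem denseRange_toCompletion :
    DenseRange (toCompletion : SymTensor m (d + 1) (PreSobolev (d + 1) s t) → _) := by
  have hpi : DenseRange (Pi.map fun (_ : Fin m → Fin (d + 1)) (x : PreSobolev (d + 1) s t) =>
      (x : Sobolev (d + 1) s t)) :=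
    DenseRange.piMap (f := fun _ (x : PreSobolev (d + 1) s t) => (x : Sobolev (d + 1) s t))
      fun _ => UniformSpace.Completion.denseRange_coe
  have hcont : Continuous (symmetrize : ((Fin m → Fin (d + 1)) → Sobolev (d + 1) s t) → _) := by
    refine Continuous.subtype_mk (continuous_pi fun I => ?_) _
    have hτ : ∀ τ : Equiv.Perm (Fin m),
        Continuous fun u : (Fin m → Fin (d + 1)) → Sobolev (d + 1) s t => u (I ∘ τ) :=
      fun τ => continuous_apply _
    exact (continuous_const_smul ((m ! : ℂ)⁻¹)).comp (continuous_finsetSum _ fun τ _ => hτ τ)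
  have hsurj : Function.Surjective
      (symmetrize : ((Fin m → Fin (d + 1)) → Sobolev (d + 1) s t) → _) := fun u => by
    refine ⟨u.1, Subtype.ext (funext fun I => ?_)⟩
    have hm : ((m ! : ℕ) : ℂ) ≠ 0 := by exact_mod_cast Nat.factorial_ne_zero m
    change ((m ! : ℂ)⁻¹) • ∑ τ : Equiv.Perm (Fin m), u.1 (I ∘ τ) = u.1 I
    simp only [u.2 _ I, Finset.sum_const, Finset.card_univ, Fintype.card_perm, Fintype.card_fin]
    rw [← Nat.cast_smul_eq_nsmul ℂ, smul_smul, inv_mul_cancel₀ hm, one_smul]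
  refine (hsurj.denseRange.comp hpi hcont).mono ?_
  rintro _ ⟨g, rfl⟩
  refine ⟨symmetrize g, Subtype.ext (funext fun I => ?_)⟩
  change UniformSpace.Completion.toComplL (𝕜 := ℂ) (((m ! : ℂ)⁻¹) • ∑ τ : Equiv.Perm (Fin m),
    g (I ∘ τ)) = ((m ! : ℂ)⁻¹) • ∑ τ : Equiv.Perm (Fin m), (g (I ∘ τ) : Sobolev (d + 1) s t)
  rw [map_smul, map_sum]
  rfl

/-- The transforms of Schwartz fields converge to the explicit formula `radonHat` by the uniform
bound, and a limit is unique up to distance zero. The definition by density is thereby replaced by a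
formula. -/
theorem isRadon_iff (F : Frame d) (ℓ : Fin (d + 1) → ℕ) (hℓ : ∑ j, ℓ j = m)
    (f : SymTensor m (d + 1) (Sobolev (d + 1) s t))
    (G : Metric.sphere (0 : E (d + 1)) 1 → ℝ → ℂ) :
    IsRadon F ℓ hℓ f G ↔ Measurable (Function.uncurry G) ∧
      sphereNormSq (s + (d : ℝ) / 2) (t + (d : ℝ) / 2)
        (fun ω σ => radonHat F ℓ hℓ s t (value f) ω σ - G ω σ) = 0 := by
  refine and_congr_right fun hG => ?_
  have hR : Measurable (Function.uncurry (radonHat F ℓ hℓ s t (value f))) :=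
    measurable_radonHat F ℓ hℓ (measurable_value f)
  have hS : ∀ g : SymTensor m (d + 1) (PreSobolev (d + 1) s t),
      Measurable (Function.uncurry (radonHat F ℓ hℓ s t (schwartzValue g))) := fun g =>
    measurable_radonHat F ℓ hℓ (measurable_schwartzValue g)
  have h0 := tendsto_sphereNormSq_schwartz_sub F ℓ hℓ f
  have hcongr : ∀ g : SymTensor m (d + 1) (PreSobolev (d + 1) s t),
      sphereNormSq (s + (d : ℝ) / 2) (t + (d : ℝ) / 2) (fun ω σ =>
        hatP (schwartzRadon F ℓ hℓ (SymTensor.map PreSobolev.toSchwartz g) ω) σ - G ω σ) =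
      sphereNormSq (s + (d : ℝ) / 2) (t + (d : ℝ) / 2) (fun ω σ =>
        radonHat F ℓ hℓ s t (schwartzValue g) ω σ - G ω σ) := fun g =>
    sphereNormSq_congr fun ω σ hσ => by rw [hatP_eq_radonHat F ℓ hℓ g ω hσ]
  simp_rw [hcongr]
  -- Density of the Schwartz fields makes the filter nontrivial; otherwise every `G` would be a
  -- limit.
  have : (comap (toCompletion : SymTensor m (d + 1) (PreSobolev (d + 1) s t) → _) (𝓝 f)).NeBot :=
    comap_neBot fun _ hs => denseRange_toCompletion.mem_nhds hs
  change Tendsto _ (comap toCompletion (𝓝 f)) (𝓝 0) ↔ _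
  constructor
  · intro h
    have h1 := (ENNReal.Tendsto.const_mul (a := 2) h0 (Or.inr (by simp))).add
      (ENNReal.Tendsto.const_mul (a := 2) h (Or.inr (by simp)))
    rw [mul_zero, add_zero] at h1
    refine le_antisymm (ge_of_tendsto' h1 fun g => ?_) bot_le
    rw [sphereNormSq_sub_comm (radonHat F ℓ hℓ s t (schwartzValue g))]
    exact sphereNormSq_sub_le hR (hS g)
  · intro h
    have h1 := (ENNReal.Tendsto.const_mul (a := 2) h0 (Or.inr (by simp))).add
      (tendsto_const_nhds (x := 2 * sphereNormSq (s + (d : ℝ) / 2) (t + (d : ℝ) / 2)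
        (fun ω σ => radonHat F ℓ hℓ s t (value f) ω σ - G ω σ)))
    rw [h, mul_zero, add_zero] at h1
    refine tendsto_of_tendsto_of_tendsto_of_le_of_le tendsto_const_nhds h1 (fun _ => bot_le)
      fun g => ?_
    have h2 := sphereNormSq_sub_le (s := s + (d : ℝ) / 2) (t := t + (d : ℝ) / 2) (C := G) (hS g) hR
    rwa [h, mul_zero] at h2

end Radon

end TensorRadon

/-! ### Vanishing of the transforms and the component they detect -/

namespace TensorRadon

section Radon

variable {d m : ℕ} {s t : ℝ}

/-- The squared norm is half the sum of two integrals of nonnegative functions, so it is zero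
exactly when the pairings in both antipodal frames vanish almost everywhere. -/
theorem radonVanishes_iff (F : Frame d) (ℓ : Fin (d + 1) → ℕ) (hℓ : ∑ j, ℓ j = m)
    (f : SymTensor m (d + 1) (Sobolev (d + 1) s t)) :
    RadonVanishes F ℓ hℓ f ↔ ∀ᵐ y, pairing (F.basis (direction y)) ℓ hℓ (value f y) = 0 ∧
      pairing (F.basis (-direction y)) ℓ hℓ (value f y) = 0 := by
  have hm1 : Measurable fun y => pairing (F.basis (direction y)) ℓ hℓ (value f y) :=
    measurable_pairing F ℓ hℓ measurable_direction (measurable_value f)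
  have hneg : Measurable fun y : E (d + 1) => -direction y :=
    Measurable.subtype_mk (measurable_subtype_coe.comp measurable_direction).neg
  have hm2 : Measurable fun y => pairing (F.basis (-direction y)) ℓ hℓ (value f y) :=
    measurable_pairing F ℓ hℓ hneg (measurable_value f)
  have h0 : Measurable (Function.uncurry (0 : Metric.sphere (0 : E (d + 1)) 1 → ℝ → ℂ)) :=
    (measurable_const : Measurable fun _ : Metric.sphere (0 : E (d + 1)) 1 × ℝ => (0 : ℂ))
  have hz : sphereNormSq (s + (d : ℝ) / 2) (t + (d : ℝ) / 2) (fun ω σ =>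
      radonHat F ℓ hℓ s t (value f) ω σ -
        (0 : Metric.sphere (0 : E (d + 1)) 1 → ℝ → ℂ) ω σ) =
      sphereNormSq (s + (d : ℝ) / 2) (t + (d : ℝ) / 2) (radonHat F ℓ hℓ s t (value f)) :=
    sphereNormSq_congr fun _ _ _ => by simp only [Pi.zero_apply, sub_zero]
  have hiff : RadonVanishes F ℓ hℓ f ↔
      sphereNormSq (s + (d : ℝ) / 2) (t + (d : ℝ) / 2) (radonHat F ℓ hℓ s t (value f)) = 0 := by
    rw [← hz]
    exact (isRadon_iff F ℓ hℓ f 0).trans (and_iff_right h0)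
  have hsq : ∀ {g : E (d + 1) → ℂ}, Measurable g →
      ((∫⁻ y, ENNReal.ofReal (‖g y‖ ^ 2)) = 0 ↔ ∀ᵐ y, g y = 0) := fun {g} hg => by
    rw [lintegral_eq_zero_iff (by fun_prop)]
    refine eventually_congr (ae_of_all _ fun y => ?_)
    simp
  rw [hiff, sphereNormSq_radonHat F ℓ hℓ (measurable_value f), mul_eq_zero,
    or_iff_right (by norm_num), add_eq_zero, hsq hm1, hsq hm2, ← eventually_and]

/-- The formula for the transform is linear in the field, so fields whose difference has vanishing
transform are represented by the same functions `G`. -/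
theorem isRadon_congr (F : Frame d) (ℓ : Fin (d + 1) → ℕ) (hℓ : ∑ j, ℓ j = m)
    {f f' : SymTensor m (d + 1) (Sobolev (d + 1) s t)} (h : RadonVanishes F ℓ hℓ (f - f'))
    (G : Metric.sphere (0 : E (d + 1)) 1 → ℝ → ℂ) :
    IsRadon F ℓ hℓ f G ↔ IsRadon F ℓ hℓ f' G := by
  have hR := fun f : SymTensor m (d + 1) (Sobolev (d + 1) s t) =>
    measurable_radonHat (s := s) (t := t) F ℓ hℓ (measurable_value f)
  have h1 : sphereNormSq (s + (d : ℝ) / 2) (t + (d : ℝ) / 2) (fun ω σ =>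
      radonHat F ℓ hℓ s t (value f) ω σ - radonHat F ℓ hℓ s t (value f') ω σ) = 0 := by
    rw [RadonVanishes, isRadon_iff] at h
    have h2 := h.2
    simp only [Pi.zero_apply, sub_zero] at h2
    rw [← h2]
    simp_rw [← radonHat_sub]
    refine sphereNormSq_radonHat_congr F ℓ hℓ (fun I => ?_) (measurable_value _) ?_
    · exact (measurable_value f I).sub (measurable_value f' I)
    · filter_upwards [value_sub f f'] with y hy
      rw [hy, Pi.sub_apply]
  rw [isRadon_iff, isRadon_iff]
  refine and_congr_right fun hG => ⟨fun h => ?_, fun h => ?_⟩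
  · refine le_antisymm ((sphereNormSq_sub_le (hR f') (hR f)).trans ?_) bot_le
    rw [h, sphereNormSq_sub_comm, h1]
    simp
  · refine le_antisymm ((sphereNormSq_sub_le (hR f) (hR f')).trans ?_) bot_le
    rw [h, h1]
    simp

/-- The transforms whose degree in the normal direction is `r` see only the component `v r`. -/
theorem forall_radonVanishes_iff (F : Frame d) (r : Fin (m + 1))
    (v : ∀ i : Fin (m + 1), SymTensor (m - i) (d + 1) (Sobolev (d + 1) (s + (i : ℕ)) (t + (i : ℕ))))
    (hv : ∀ i : Fin (m + 1), (i : ℕ) < m → IsDivergenceFree (v i)) :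
    (∀ (ℓ : Fin (d + 1) → ℕ) (hℓ : ∑ j, ℓ j = m), ℓ (Fin.last d) = r →
      RadonVanishes F ℓ hℓ (∑ i, potential i (v i))) ↔ v r = 0 := by
  have key := forall_pairing_value_sum_potential_iff v hv r
  constructor
  · intro h
    have h1 : ∀ᵐ y, ∀ (ℓ : Fin (d + 1) → ℕ), ∀ (hℓ : ∑ j, ℓ j = m), ℓ (Fin.last d) = r →
        pairing (F.basis (direction y)) ℓ hℓ (value (∑ i, potential i (v i)) y) = 0 := by
      -- There are countably many exponents `ℓ`, so the exceptional null sets may be united.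
      simp only [ae_all_iff]
      intro ℓ hℓ hr
      filter_upwards [(radonVanishes_iff F ℓ hℓ _).1 (h ℓ hℓ hr)] with y hy using hy.1
    refine eq_of_value_ae_eq ?_
    filter_upwards [key, h1, ae_ne_zero d.succ_pos, value_zero (m := m - r) (n := d + 1)
      (s := s + (r : ℕ)) (t := t + (r : ℕ))] with y h2 h3 h4 h5
    rw [h5]
    exact (h2 _ _ Complex.I_ne_zero (multiplier_eq_direction F h4)).1 h3
  -- The forward implication needed only the frame at `y/|y|`; here the antipodal frame must be
  -- treated as well, with the scalar `-i`.
  · intro h ℓ hℓ hr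
    rw [radonVanishes_iff]
    filter_upwards [key, ae_ne_zero d.succ_pos, value_zero (m := m - r) (n := d + 1)
      (s := s + (r : ℕ)) (t := t + (r : ℕ))] with y h2 h4 h5
    rw [← h] at h5
    exact ⟨(h2 _ _ Complex.I_ne_zero (multiplier_eq_direction F h4)).2 h5 ℓ hℓ hr,
      (h2 _ _ (neg_ne_zero.2 Complex.I_ne_zero) (multiplier_eq_neg_direction F h4)).2 h5 ℓ hℓ hr⟩

theorem radonVanishes_sum_erase (F : Frame d) (r : Fin (m + 1))
    (v : ∀ i : Fin (m + 1), SymTensor (m - i) (d + 1) (Sobolev (d + 1) (s + (i : ℕ)) (t + (i : ℕ))))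
    (hv : ∀ i : Fin (m + 1), (i : ℕ) < m → IsDivergenceFree (v i)) (ℓ : Fin (d + 1) → ℕ)
    (hℓ : ∑ j, ℓ j = m) (hr : ℓ (Fin.last d) = r) :
    RadonVanishes F ℓ hℓ (∑ i ∈ Finset.univ.erase r, potential i (v i)) := by
  rw [← sum_potential_update]
  refine (forall_radonVanishes_iff F r _ fun i hi => ?_).2 (Function.update_self _ _ _) ℓ hℓ hr
  by_cases h : i = r
  · subst h
    rw [Function.update_self]
    exact IsDivergenceFree.zero
  · rw [Function.update_of_ne h]
    exact hv i hi

end Radon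

end TensorRadon

end

/-! ### The kernel theorem -/

open TensorRadon in
theorem mainTheorem1 (d m : ℕ) (s t : ℝ) (ht : -((d + 1 : ℕ) : ℝ) / 2 < t) (F : Frame d)
    (r : Fin (m + 1)) (f : SymTensor m (d + 1) (Sobolev (d + 1) s t)) :
    ((∀ (ℓ : Fin (d + 1) → ℕ) (hℓ : ∑ j, ℓ j = m), ℓ (Fin.last d) = r →
        RadonVanishes F ℓ hℓ f) ↔
      ∃ v : ∀ i : Fin (m + 1),
          SymTensor (m - i) (d + 1) (Sobolev (d + 1) (s + (i : ℕ)) (t + (i : ℕ))),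
        (∀ i : Fin (m + 1), (i : ℕ) < m → IsDivergenceFree (v i)) ∧
        f = ∑ i ∈ Finset.univ.erase r, potential i (v i)) ∧
    ∀ v : ∀ i : Fin (m + 1),
        SymTensor (m - i) (d + 1) (Sobolev (d + 1) (s + (i : ℕ)) (t + (i : ℕ))),
      (∀ i : Fin (m + 1), (i : ℕ) < m → IsDivergenceFree (v i)) →
      f = ∑ i, potential i (v i) →
      (∀ (ℓ : Fin (d + 1) → ℕ) (hℓ : ∑ j, ℓ j = m), ℓ (Fin.last d) = r →
        ∀ G, IsRadon F ℓ hℓ f G ↔ IsRadon F ℓ hℓ (potential r (v r)) G) ∧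
      ((∀ (ℓ : Fin (d + 1) → ℕ) (hℓ : ∑ j, ℓ j = m), ℓ (Fin.last d) = r →
        RadonVanishes F ℓ hℓ f) ↔ v r = 0) := by
  refine ⟨⟨fun h => ?_, ?_⟩, ?_⟩
  · obtain ⟨v, hv, rfl⟩ := exists_eq_sum_potential F f
    refine ⟨v, hv, ?_⟩
    -- Decompose `f` completely; the vanishing transforms force `v r = 0`, so its term drops out.
    rw [← Finset.add_sum_erase _ _ (Finset.mem_univ r), (forall_radonVanishes_iff F r v hv).1 h,
      potential_zero, zero_add]
  · rintro ⟨v, hv, rfl⟩ ℓ hℓ hr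
    exact radonVanishes_sum_erase F r v hv ℓ hℓ hr
  · rintro v hv rfl
    refine ⟨fun ℓ hℓ hr G => isRadon_congr F ℓ hℓ ?_ G, forall_radonVanishes_iff F r v hv⟩
    -- The difference between `f` and its `r`-th term is the sum over the other indices, which these
    -- transforms annihilate.
    rw [← Finset.add_sum_erase _ _ (Finset.mem_univ r), add_sub_cancel_left]
    exact radonVanishes_sum_erase F r v hv ℓ hℓ hr
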